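/- Let $m\ge 2$ and $n\ge 1$ be integers, $\sigma>0$, and let $z^*\in\mathbb{C}^n$ be a deterministic vector with $|z^*_j|=1$ for all $j$. Let $W\in\mathbb{C}^{n\times n}$ be a random Hermitian matrix with zero diagonal whose entries $W_{jk}$, $1\le j<k\le n$, are independent standard complex Gaussian variables (independent real and imaginary parts, each $N(0,1/2)$), and put $Y=z^*(z^*)^{\mathsf H}+\sigma W$. Write $\langle A,B\rangle=\operatorname{Tr}(A^{\mathsf H}B)$, and let $\|\cdot\|$ and $\|\cdot\|_{\mathrm F}$ be the operator and the Frobenius norm of a matrix. Let $\hat z^{\mathrm{MLE}}$ be any random vector that almost surely maximizes $\langle Y,zz^{\mathsf H}\rangle$ over all $z\in\mathbb{C}^n$ with $|z_j|=1$ for all $j$, and let $\hat V^{\mathrm{BM},m}$ be any random matrix that almost surely maximizes $\langle Y,V^{\mathsf H}V\rangle$ over all $V\in\mathbb{C}^{m\times n}$ whose columns have Euclidean norm $1$. For $V\in\mathbb{C}^{m\times n}$ and $z\in\mathbb{C}^n$ let $$\ell_m(V,z)=\min_{a\in\mathbb{C}^m,\ \|a\|=1}\frac1n\,\|V-az^{\mathsf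 H}\|_{\mathrm F}^2 .$$ There is an absolute constant $C_0>0$ such that $\mathbb{P}(\|W\|\le C_0\sqrt n)\ge 1-n^{-10}$ for every $n\ge1$. For every such $C_0$ there are constants $C_1,C_2>0$ depending only on $C_0$ (and not on $m,n,\sigma,z^*$ or on the choice of the maximizers) such that: 1. if $\frac{n}{\sigma^2}\ge C_1$, then $\mathbb{E}\,\ell_m(\hat V^{\mathrm{BM},m},\hat z^{\mathrm{MLE}})\le \exp\!\left(-\frac{n}{8\sigma^2}\right)+n^{-10}$; 2. if $\frac{n}{\sigma^2}\ge\max\{C_2,\,9\log n\}$, then $\ell_m(\hat V^{\mathrm{BM},m},\hat z^{\mathrm{MLE}})=0$ with probability at least $1-n^{-1}$. -/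

import Mathlib

open MeasureTheory ProbabilityTheory Matrix

universe u

namespace PhaseSync

noncomputable section

/-- The standard complex Gaussian distribution on `ℂ`: real and imaginary parts are independent
real Gaussians with mean `0` and variance `1/2`, so that `E |X|² = 1`. -/
def stdComplexGaussian : Measure ℂ :=
  ((gaussianReal 0 (1 / 2)).prod (gaussianReal 0 (1 / 2))).map Complex.measurableEquivRealProd.symm

/-- `W` is the (random) noise matrix on the probability space `(Ω, P)`: Hermitian with zero
diagonal, and the entries above the diagonal are independent standard complex Gaussians. -/
structure IsNoiseMatrix {n : ℕ} {Ω : Type u} [MeasurableSpace Ω] (P : Measure Ω)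
    (W : Ω → Matrix (Fin n) (Fin n) ℂ) : Prop where
  law : ∀ j k : Fin n, j < k → HasLaw (fun ω => W ω j k) stdComplexGaussian P
  indep : iIndepFun (fun (p : {p : Fin n × Fin n // p.1 < p.2}) (ω : Ω) => W ω p.1.1 p.1.2) P
  diag : ∀ ω j, W ω j j = 0
  herm : ∀ ω, (W ω).IsHermitian

/-- The operator norm of a square complex matrix with respect to the Euclidean norm. -/
def opNorm {n : ℕ} (B : Matrix (Fin n) (Fin n) ℂ) : ℝ :=
  ‖Matrix.toEuclideanCLM (n := Fin n) (𝕜 := ℂ) B‖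

/-- `C₀` is a constant such that `P(‖W‖ ≤ C₀ √n) ≥ 1 - n^{-10}` for every size `n ≥ 1` of the
noise matrix. -/
def IsNoiseNormConst (C₀ : ℝ) : Prop :=
  ∀ (n : ℕ), 1 ≤ n → ∀ (Ω : Type u) [MeasurableSpace Ω] (P : Measure Ω) [IsProbabilityMeasure P]
    (W : Ω → Matrix (Fin n) (Fin n) ℂ), IsNoiseMatrix P W →
      1 - (n : ℝ) ^ (-10 : ℤ) ≤ P.real {ω | opNorm (W ω) ≤ C₀ * √(n : ℝ)}

/-- The vectors with unit modulus coordinates. -/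
def phases (n : ℕ) : Set (Fin n → ℂ) := {z | ∀ j, ‖z j‖ = 1}

/-- The `m × n` complex matrices whose columns have unit Euclidean norm. -/
def unitCols (m n : ℕ) : Set (Matrix (Fin m) (Fin n) ℂ) := {V | ∀ j, ∑ i, ‖V i j‖ ^ 2 = 1}

/-- The observed matrix `Y = z* (z*)ᴴ + σ W`. -/
def obs {n : ℕ} (σ : ℝ) (zstar : Fin n → ℂ) (W : Matrix (Fin n) (Fin n) ℂ) :
    Matrix (Fin n) (Fin n) ℂ :=
  vecMulVec zstar (star zstar) + (σ : ℂ) • W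

/-- The (real part of the) Frobenius inner product `⟨A, B⟩ = Tr (Aᴴ B)`; for Hermitian `A` and `B`
the inner product is real. -/
def frobInner {n : ℕ} (A B : Matrix (Fin n) (Fin n) ℂ) : ℝ := (Aᴴ * B).trace.re

/-- `z` is a maximum likelihood estimate: a maximizer of `⟨Y, z zᴴ⟩` over vectors of phases. -/
def IsMLE {n : ℕ} (Y : Matrix (Fin n) (Fin n) ℂ) (z : Fin n → ℂ) : Prop :=
  z ∈ phases n ∧ IsMaxOn (fun x : Fin n → ℂ => frobInner Y (vecMulVec x (star x))) (phases n) z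

/-- `V` is a solution of the Burer-Monteiro factorization: a maximizer of `⟨Y, Vᴴ V⟩` over `m × n`
matrices with unit columns. -/
def IsBM {m n : ℕ} (Y : Matrix (Fin n) (Fin n) ℂ) (V : Matrix (Fin m) (Fin n) ℂ) : Prop :=
  V ∈ unitCols m n ∧
    IsMaxOn (fun X : Matrix (Fin m) (Fin n) ℂ => frobInner Y (Xᴴ * X)) (unitCols m n) V

/-- The loss `ℓ_m(V, z) = min_{‖a‖ = 1} n⁻¹ ‖V - a zᴴ‖_F²`, where `a` runs over the unit sphere
of `ℂᵐ`. -/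
def loss {m n : ℕ} (V : Matrix (Fin m) (Fin n) ℂ) (z : Fin n → ℂ) : ℝ :=
  ⨅ a : Metric.sphere (0 : EuclideanSpace ℂ (Fin m)) 1,
    (1 / (n : ℝ)) * ∑ i, ∑ j, ‖V i j - a.1 i * star (z j)‖ ^ 2

end

end PhaseSync

/-!
The maximizers `V` and `z` are compared with a third object, a fixed point `x` that depends on the
noise only. After conjugating by the phases of the signal (`gauge`), the signal is `1 1ᵀ`; the
maximum likelihood estimate is then the one-row case of the Burer-Monteiro problem (`IsMLE.isBM`),
so a single argument serves for both.

*Deterministic part.* Optimality of column `j` forces it to be a positive multiple of column `j` of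
`V Y` (`exists_act_apply_eq_smul`), and comparison with a constant competitor shows that the mean
of the columns has norm close to `1`. With `e` the direction of the mean, column `j` is therefore
the normalization of `e + s c (V A)_j`, where `A` is the noise, `s = σ / n`, and `c` is the inverse
norm of the mean (`exists_drift_eq_smul`). Replacing the normalization by the Lipschitz map `clip`
and `c` by a truncated version gives a map `step` which is a contraction in Frobenius norm once
`s ‖A‖` is small. Its scalar version has a fixed point `x = fixedPoint s A`. Since `clip` agrees
with the normalization away from the origin, `V - e xᵀ` is controlled by the number of columns at
which the noise term `s (x A)_j` is large (`norm_sub_rankOne_sq_le`), and the same holds for `z`.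
Hence the loss is at most `16 / n` times this number (`loss_le_card`); if there is no such column,
the two optimizers coincide up to a unit vector.

*Leave-one-out.* Erasing row and column `j` of `A` moves the fixed point by `O(1)` in Euclidean norm
(`norm_fixedPoint_sub_eraseIndex_le`), which changes `s (x A)_j` by `O(s ‖A‖)` only. The modified
fixed point is independent of column `j`, so the event that column `j` is bad has probability at
most `4 exp (-9 n / (32 σ²))` (`exists_measurableSet_large_noise`). The constant `9 / 32` exceeds
both `1 / 8` and `2 / 9`, as needed for the expectation and for the union bound over `j`.

*Norm of the noise.* The bound `‖W‖ ≤ 100 √n` fails with probability at most `exp (-20 n)`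
(`entriesLaw_opNorm_gt_le`). As the loss is at most `4`, this event contributes at most `n⁻¹⁰` to
the expectation. The constants `C₁` and `C₂` obtained this way are absolute.
-/

namespace PhaseSync

/-! ### The regularized power iteration -/

section Iteration

variable {n : ℕ} {E : Type*} [NormedAddCommGroup E]

lemma norm_le_of_forall_le {E' : Type*} [NormedAddCommGroup E'] {c : ℝ} (hc : 0 ≤ c)
    {x : PiLp 2 (fun _ : Fin n => E)} {y : PiLp 2 (fun _ : Fin n => E')}
    (h : ∀ j, ‖x j‖ ≤ c * ‖y j‖) : ‖x‖ ≤ c * ‖y‖ := by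
  refine le_of_sq_le_sq ?_ (by positivity)
  rw [mul_pow, PiLp.norm_sq_eq_of_L2, PiLp.norm_sq_eq_of_L2, Finset.mul_sum]
  refine Finset.sum_le_sum fun j _ => ?_
  rw [← mul_pow]
  exact pow_le_pow_left₀ (norm_nonneg _) (h j) 2

lemma norm_sq_le_card {x : PiLp 2 (fun _ : Fin n => E)} (h : ∀ j, ‖x j‖ ≤ 1) :
    ‖x‖ ^ 2 ≤ n := by
  rw [PiLp.norm_sq_eq_of_L2]
  calc ∑ j, ‖x j‖ ^ 2 ≤ ∑ _j : Fin n, (1 : ℝ) :=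
        Finset.sum_le_sum fun j _ => pow_le_one₀ (norm_nonneg _) (h j)
    _ = n := by simp

lemma norm_le_sqrt_card {x : PiLp 2 (fun _ : Fin n => E)} (h : ∀ j, ‖x j‖ ≤ 1) :
    ‖x‖ ≤ √(n : ℝ) := Real.le_sqrt_of_sq_le (norm_sq_le_card h)

variable [InnerProductSpace ℂ E]

/-- The matrix product `V A`, where `V` is given by its list of columns. -/
noncomputable def act (A : Fin n → Fin n → ℂ) (V : PiLp 2 (fun _ : Fin n => E)) :
    PiLp 2 (fun _ : Fin n => E) :=
  WithLp.toLp 2 fun j => ∑ k, A k j • V k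

@[simp] lemma act_apply (A : Fin n → Fin n → ℂ) (V : PiLp 2 (fun _ : Fin n => E)) (j : Fin n) :
    act A V j = ∑ k, A k j • V k := rfl

/-- `K` bounds the Euclidean operator norm of `v ↦ v A`. -/
def ActBound (A : Fin n → Fin n → ℂ) (K : ℝ) : Prop :=
  ∀ v : PiLp 2 (fun _ : Fin n => ℂ), ‖act A v‖ ≤ K * ‖v‖

lemma act_sub (A : Fin n → Fin n → ℂ) (V U : PiLp 2 (fun _ : Fin n => E)) :
    act A (V - U) = act A V - act A U := by
  ext j
  simp [act, smul_sub, Finset.sum_sub_distrib]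

/-- A bound for the action on scalar rows passes to all matrices with columns in a
finite-dimensional Hilbert space, since the rows are acted on separately. -/
lemma ActBound.norm_act_le [FiniteDimensional ℂ E] {A : Fin n → Fin n → ℂ} {K : ℝ}
    (hA : ActBound A K) (hK : 0 ≤ K) (V : PiLp 2 (fun _ : Fin n => E)) :
    ‖act A V‖ ≤ K * ‖V‖ := by
  let b := stdOrthonormalBasis ℂ E
  let v : Fin (Module.finrank ℂ E) → PiLp 2 (fun _ : Fin n => ℂ) :=
    fun i => WithLp.toLp 2 fun k => inner ℂ (b i) (V k)
  have hnorm : ∀ U : PiLp 2 (fun _ : Fin n => E),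
      ‖U‖ ^ 2 = ∑ i, ∑ j, ‖inner ℂ (b i) (U j)‖ ^ 2 := by
    intro U
    rw [PiLp.norm_sq_eq_of_L2, Finset.sum_comm]
    exact Finset.sum_congr rfl fun j _ => (b.sum_sq_norm_inner_right (U j)).symm
  refine le_of_sq_le_sq ?_ (by positivity)
  rw [mul_pow, hnorm, hnorm, Finset.mul_sum]
  refine Finset.sum_le_sum fun i _ => ?_
  have h := pow_le_pow_left₀ (norm_nonneg _) (hA (v i)) 2
  rw [mul_pow, PiLp.norm_sq_eq_of_L2, PiLp.norm_sq_eq_of_L2] at h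
  simpa [v, inner_sum, inner_smul_right] using h

/-- Radial truncation: `clip w` is `w / ‖w‖` outside the ball of radius `1/16`. It is a globally
Lipschitz replacement for the normalization `w ↦ w / ‖w‖`. -/
noncomputable def clip (w : E) : E := (((max ‖w‖ (1 / 16))⁻¹ : ℝ) : ℂ) • w

lemma norm_clip_le_one (w : E) : ‖clip w‖ ≤ 1 := by
  have h : (0 : ℝ) < max ‖w‖ (1 / 16) := lt_max_of_lt_right (by norm_num)
  rw [clip, norm_smul, Complex.norm_real, norm_inv, Real.norm_of_nonneg h.le, inv_mul_le_iff₀ h]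
  simp

lemma norm_clip_sub_clip_le (w v : E) : ‖clip w - clip v‖ ≤ 32 * ‖w - v‖ := by
  set a := max ‖w‖ (1 / 16) with ha
  set b := max ‖v‖ (1 / 16) with hb
  have ha0 : (1 / 16 : ℝ) ≤ a := le_max_right _ _
  have hb0 : (1 / 16 : ℝ) ≤ b := le_max_right _ _
  have hvb : ‖v‖ ≤ b := le_max_left _ _
  have hab : |b - a| ≤ ‖w - v‖ := by
    rw [abs_sub_comm]
    refine (abs_max_sub_max_le_abs _ _ _).trans (abs_norm_sub_norm_le _ _)
  have hdec : clip w - clip v =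
      ((a⁻¹ : ℝ) : ℂ) • (w - v) + ((a⁻¹ * b⁻¹ * (b - a) : ℝ) : ℂ) • v := by
    have : a⁻¹ * b⁻¹ * (b - a) = a⁻¹ - b⁻¹ := by
      field_simp
    rw [this, clip, clip, ← ha, ← hb]
    push_cast
    module
  have hainv : a⁻¹ ≤ 16 := by
    rw [inv_le_comm₀ (by linarith) (by norm_num)]; linarith
  have hbv : b⁻¹ * ‖v‖ ≤ 1 := by
    rw [inv_mul_le_iff₀ (by linarith)]; linarith
  have hapos : 0 < a⁻¹ := inv_pos.2 (by linarith)
  have hbpos : 0 < b⁻¹ := inv_pos.2 (by linarith)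
  rw [hdec]
  refine (norm_add_le _ _).trans ?_
  rw [norm_smul, norm_smul, Complex.norm_real, Complex.norm_real, Real.norm_eq_abs,
    Real.norm_eq_abs, abs_mul, abs_mul, abs_of_pos hapos, abs_of_pos hbpos]
  have h1 : a⁻¹ * ‖w - v‖ ≤ 16 * ‖w - v‖ := by gcongr
  have h2 : a⁻¹ * b⁻¹ * |b - a| * ‖v‖ ≤ 16 * ‖w - v‖ := by
    calc a⁻¹ * b⁻¹ * |b - a| * ‖v‖ = a⁻¹ * |b - a| * (b⁻¹ * ‖v‖) := by ring
      _ ≤ 16 * ‖w - v‖ * 1 := by gcongr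
      _ = _ := by ring
  linarith

lemma clip_smul_of_norm_one {e : E} (he : ‖e‖ = 1) (w : ℂ) : clip (w • e) = clip w • e := by
  simp [clip, norm_smul, he, smul_smul]

lemma clip_smul_of_le {v : E} (hv : ‖v‖ = 1) {r : ℝ} (hr : 1 / 16 ≤ r) :
    clip ((r : ℂ) • v) = v := by
  have h0 : 0 < r := by linarith
  have : ((r⁻¹ : ℝ) : ℂ) * (r : ℂ) = 1 := by
    rw [← Complex.ofReal_mul, inv_mul_cancel₀ h0.ne', Complex.ofReal_one]
  rw [clip, norm_smul, hv, Complex.norm_real, Real.norm_of_nonneg h0.le, mul_one,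
    max_eq_left hr, smul_smul, this, one_smul]

/-- Below the truncation radius, `clip` still points in the right direction. -/
lemma norm_sub_clip_smul_le {v : E} (hv : ‖v‖ = 1) {r : ℝ} (h0 : 0 ≤ r) (hr : r ≤ 1 / 16) :
    ‖v - clip ((r : ℂ) • v)‖ ≤ 1 := by
  have : v - clip ((r : ℂ) • v) = ((1 - 16 * r : ℝ) : ℂ) • v := by
    rw [clip, norm_smul, hv, Complex.norm_real, Real.norm_of_nonneg h0, mul_one,
      max_eq_right hr]
    push_cast
    norm_num
    module
  rw [this, norm_smul, hv, Complex.norm_real, mul_one, Real.norm_eq_abs, abs_le]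
  constructor <;> linarith

/-- The component along `e` of the mean of the columns of `V`. -/
noncomputable def align (e : E) (V : PiLp 2 (fun _ : Fin n => E)) : ℝ :=
  (∑ j, (inner ℂ e (V j)).re) / n

lemma abs_align_sub_le {e : E} (he : ‖e‖ = 1) (V U : PiLp 2 (fun _ : Fin n => E)) :
    √(n : ℝ) * |align e V - align e U| ≤ ‖V - U‖ := by
  rcases Nat.eq_zero_or_pos n with rfl | hn
  · simp
  have hn' : (0 : ℝ) < n := by exact_mod_cast hn
  have h1 : |align e V - align e U| ≤ (∑ j, ‖(V - U) j‖) / n := by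
    rw [align, align, ← sub_div, ← Finset.sum_sub_distrib, abs_div, abs_of_pos hn']
    gcongr
    refine (Finset.abs_sum_le_sum_abs _ _).trans (Finset.sum_le_sum fun j _ => ?_)
    rw [← Complex.sub_re, ← inner_sub_right]
    refine (Complex.abs_re_le_norm _).trans ((norm_inner_le_norm _ _).trans ?_)
    simp [he]
  have h2 : (∑ j, ‖(V - U) j‖) ^ 2 ≤ n * ‖V - U‖ ^ 2 := by
    rw [PiLp.norm_sq_eq_of_L2]
    simpa using sq_sum_le_card_mul_sum_sq (s := Finset.univ) (f := fun j => ‖(V - U) j‖)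
  have h3 : ∑ j, ‖(V - U) j‖ ≤ √n * ‖V - U‖ := by
    refine le_of_sq_le_sq ?_ (by positivity)
    rw [mul_pow, Real.sq_sqrt hn'.le]; exact h2
  calc √(n : ℝ) * |align e V - align e U| ≤ √n * ((√n * ‖V - U‖) / n) := by
        gcongr; exact h1.trans (by gcongr)
    _ = (√n * √n) * ‖V - U‖ / n := by ring
    _ = ‖V - U‖ := by rw [Real.mul_self_sqrt hn'.le]; field_simp

/-- The columns of `e 1ᵀ + s c V A`, with `c` the truncated inverse of the alignment of `V`
with `e`. -/
noncomputable def drift (s : ℝ) (A : Fin n → Fin n → ℂ) (e : E)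
    (V : PiLp 2 (fun _ : Fin n => E)) : PiLp 2 (fun _ : Fin n => E) :=
  WithLp.toLp 2 fun j => e + ((s * (max (align e V) (1 / 2))⁻¹ : ℝ) : ℂ) • act A V j

/-- The regularized power iteration: one step of the fixed-point equation of the optimizers with
the normalization replaced by `clip`. -/
noncomputable def step (s : ℝ) (A : Fin n → Fin n → ℂ) (e : E)
    (V : PiLp 2 (fun _ : Fin n => E)) : PiLp 2 (fun _ : Fin n => E) :=
  WithLp.toLp 2 fun j => clip (drift s A e V j)

lemma inv_max_half_le (x : ℝ) : 0 < (max x (1 / 2))⁻¹ ∧ (max x (1 / 2))⁻¹ ≤ 2 := by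
  have : (1 / 2 : ℝ) ≤ max x (1 / 2) := le_max_right _ _
  refine ⟨inv_pos.2 (by linarith), ?_⟩
  rw [inv_le_comm₀ (by linarith) (by norm_num)]; linarith

lemma abs_inv_max_half_sub_le (x y : ℝ) :
    |(max x (1 / 2))⁻¹ - (max y (1 / 2))⁻¹| ≤ 4 * |x - y| := by
  have hx := inv_max_half_le x
  have hy := inv_max_half_le y
  have hx' : (max x (1 / 2)) ≠ 0 := by have := le_max_right x (1 / 2); linarith
  have hy' : (max y (1 / 2)) ≠ 0 := by have := le_max_right y (1 / 2); linarith
  have h : (max x (1 / 2))⁻¹ - (max y (1 / 2))⁻¹ =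
      (max x (1 / 2))⁻¹ * (max y (1 / 2))⁻¹ * (max y (1 / 2) - max x (1 / 2)) := by
    field_simp
  rw [h, abs_mul, abs_mul, abs_of_pos hx.1, abs_of_pos hy.1, abs_sub_comm x y]
  have := abs_max_sub_max_le_abs y x (1 / 2)
  calc _ ≤ 2 * 2 * |y - x| := by
        gcongr
        exacts [hx.2, hy.2]
    _ = _ := by ring

lemma norm_drift_sub_le [FiniteDimensional ℂ E] {A : Fin n → Fin n → ℂ} {K s : ℝ}
    (hA : ActBound A K) (hK : 0 ≤ K) (hs : 0 ≤ s) {e : E} (he : ‖e‖ = 1)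
    (V : PiLp 2 (fun _ : Fin n => E)) {U : PiLp 2 (fun _ : Fin n => E)} (hU : ∀ j, ‖U j‖ ≤ 1) :
    ‖drift s A e V - drift s A e U‖ ≤ 6 * (s * K) * ‖V - U‖ := by
  set c := (max (align e V) (1 / 2))⁻¹ with hc
  set d := (max (align e U) (1 / 2))⁻¹ with hd
  have hdec : drift s A e V - drift s A e U =
      ((s * c : ℝ) : ℂ) • act A (V - U) + ((s * (c - d) : ℝ) : ℂ) • act A U := by
    rw [act_sub]
    ext j
    simp only [drift, PiLp.sub_apply, PiLp.add_apply, PiLp.smul_apply, ← hc, ← hd]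
    push_cast
    module
  have hc2 := inv_max_half_le (align e V)
  rw [hdec]
  refine (norm_add_le _ _).trans ?_
  rw [norm_smul, norm_smul, Complex.norm_real, Complex.norm_real, Real.norm_eq_abs,
    Real.norm_eq_abs, abs_mul, abs_mul, abs_of_nonneg hs, abs_of_pos hc2.1]
  have h1 : s * c * ‖act A (V - U)‖ ≤ s * 2 * (K * ‖V - U‖) := by
    gcongr
    exacts [hc2.2, hA.norm_act_le hK _]
  have h2 : s * |c - d| * ‖act A U‖ ≤ 4 * (s * K) * ‖V - U‖ := by
    calc s * |c - d| * ‖act A U‖ ≤ s * (4 * |align e V - align e U|) * (K * √n) := by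
          gcongr
          · exact abs_inv_max_half_sub_le _ _
          · exact (hA.norm_act_le hK _).trans (by gcongr; exact norm_le_sqrt_card hU)
      _ = 4 * (s * K) * (√n * |align e V - align e U|) := by ring
      _ ≤ _ := by gcongr; exact abs_align_sub_le he V U
  linarith

lemma norm_step_sub_le_drift (s t : ℝ) (A B : Fin n → Fin n → ℂ) (e : E)
    (V U : PiLp 2 (fun _ : Fin n => E)) :
    ‖step s A e V - step t B e U‖ ≤ 32 * ‖drift s A e V - drift t B e U‖ :=
  norm_le_of_forall_le (by norm_num) fun _ => norm_clip_sub_clip_le _ _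

lemma norm_step_apply_le (s : ℝ) (A : Fin n → Fin n → ℂ) (e : E)
    (V : PiLp 2 (fun _ : Fin n => E)) (j : Fin n) : ‖step s A e V j‖ ≤ 1 :=
  norm_clip_le_one _

/-- For a small noise-to-signal parameter `s K` the regularized iteration is a contraction. -/
lemma norm_step_sub_le [FiniteDimensional ℂ E] {A : Fin n → Fin n → ℂ} {K s : ℝ}
    (hA : ActBound A K) (hK : 0 ≤ K) (hs : 0 ≤ s) (hsK : s * K ≤ 1 / 1000) {e : E} (he : ‖e‖ = 1)
    (V : PiLp 2 (fun _ : Fin n => E)) {U : PiLp 2 (fun _ : Fin n => E)} (hU : ∀ j, ‖U j‖ ≤ 1) :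
    ‖step s A e V - step s A e U‖ ≤ 1 / 2 * ‖V - U‖ := by
  refine (norm_step_sub_le_drift _ _ _ _ _ _ _).trans ?_
  have h := norm_drift_sub_le hA hK hs he V hU
  nlinarith [norm_nonneg (V - U)]

end Iteration

/-! ### Its fixed point, stability under erasing an index, and comparison with optimizers -/

section FixedPoint

variable {n : ℕ}

lemma exists_fixedPoint {A : Fin n → Fin n → ℂ} {K s : ℝ}
    (hA : ActBound A K) (hK : 0 ≤ K) (hs : 0 ≤ s) (hsK : s * K ≤ 1 / 1000) :
    ∃ x : PiLp 2 (fun _ : Fin n => ℂ), (∀ j, ‖x j‖ ≤ 1) ∧ step s A 1 x = x := by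
  let B : Set (PiLp 2 (fun _ : Fin n => ℂ)) := {x | ∀ j, ‖x j‖ ≤ 1}
  have hB : IsClosed B := by
    simp only [B, Set.ofPred_forall]
    refine isClosed_iInter fun j => isClosed_le ?_ continuous_const
    fun_prop
  have hmaps : Set.MapsTo (step s A (1 : ℂ)) B B := fun x _ j => norm_step_apply_le _ _ _ _ _
  have hcon : ContractingWith (1 / 2) (hmaps.restrict _ B B) := by
    refine ⟨by rw [← NNReal.coe_lt_coe]; norm_num, LipschitzWith.of_dist_le_mul ?_⟩
    rintro ⟨x, hx⟩ ⟨y, hy⟩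
    rw [Subtype.dist_eq, Subtype.dist_eq, dist_eq_norm, dist_eq_norm]
    simpa using norm_step_sub_le hA hK hs hsK (e := (1 : ℂ)) (by simp) x hy
  obtain ⟨y, hy, hfix, -⟩ := hcon.exists_fixedPoint' hB.isComplete hmaps
    (x := 0) (fun j => by simp) (edist_ne_top _ _)
  exact ⟨y, hy, hfix⟩

open Classical in
/-- The fixed point of the regularized scalar iteration for the matrix `A`; it is set to `0` when
there is none, which does not happen for matrices of small norm. -/
noncomputable def fixedPoint (s : ℝ) (A : Fin n → Fin n → ℂ) : PiLp 2 (fun _ : Fin n => ℂ) :=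
  if h : ∃ x : PiLp 2 (fun _ : Fin n => ℂ), (∀ j, ‖x j‖ ≤ 1) ∧ step s A 1 x = x
  then h.choose else 0

lemma norm_fixedPoint_apply_le (s : ℝ) (A : Fin n → Fin n → ℂ) (j : Fin n) :
    ‖fixedPoint s A j‖ ≤ 1 := by
  unfold fixedPoint
  split_ifs with h
  · exact h.choose_spec.1 j
  · simp

lemma step_fixedPoint {A : Fin n → Fin n → ℂ} {K s : ℝ}
    (hA : ActBound A K) (hK : 0 ≤ K) (hs : 0 ≤ s) (hsK : s * K ≤ 1 / 1000) :
    step s A 1 (fixedPoint s A) = fixedPoint s A := by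
  have h := exists_fixedPoint hA hK hs hsK
  unfold fixedPoint
  rw [dif_pos h]
  exact h.choose_spec.2

/-- Stability of the fixed point: its distance to any point of the polydisc is controlled by the
residual of that point. -/
lemma norm_fixedPoint_sub_le {A : Fin n → Fin n → ℂ} {K s : ℝ}
    (hA : ActBound A K) (hK : 0 ≤ K) (hs : 0 ≤ s) (hsK : s * K ≤ 1 / 1000)
    {y : PiLp 2 (fun _ : Fin n => ℂ)} (hy : ∀ j, ‖y j‖ ≤ 1) :
    ‖fixedPoint s A - y‖ ≤ 2 * ‖step s A 1 y - y‖ := by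
  have h1 := norm_step_sub_le hA hK hs hsK (e := (1 : ℂ)) (by simp) (fixedPoint s A) hy
  rw [step_fixedPoint hA hK hs hsK] at h1
  have h2 := norm_sub_le_norm_sub_add_norm_sub (fixedPoint s A) (step s A 1 y) y
  linarith

lemma norm_step_sub_step_apply_le {s : ℝ} (hs : 0 ≤ s) (A B : Fin n → Fin n → ℂ)
    (y : PiLp 2 (fun _ : Fin n => ℂ)) (j : Fin n) :
    ‖step s A 1 y j - step s B 1 y j‖ ≤ 64 * s * ‖act A y j - act B y j‖ := by
  refine (norm_clip_sub_clip_le _ _).trans ?_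
  have h := inv_max_half_le (align 1 y)
  have : drift s A 1 y j - drift s B 1 y j =
      ((s * (max (align 1 y) (1 / 2))⁻¹ : ℝ) : ℂ) • (act A y j - act B y j) := by
    simp only [drift]
    module
  rw [this, norm_smul, Complex.norm_real, Real.norm_of_nonneg (mul_nonneg hs h.1.le)]
  calc 32 * (s * (max (align 1 y) (1 / 2))⁻¹ * ‖act A y j - act B y j‖)
      ≤ 32 * (s * 2 * ‖act A y j - act B y j‖) := by
        gcongr
        exact h.2
    _ = _ := by ring

lemma isClosed_actBound (K : ℝ) : IsClosed {A : Fin n → Fin n → ℂ | ActBound A K} := by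
  simp only [ActBound, Set.ofPred_forall]
  refine isClosed_iInter fun v => isClosed_le ?_ continuous_const
  unfold act
  fun_prop

lemma continuousOn_fixedPoint {K s : ℝ} (hK : 0 ≤ K) (hs : 0 ≤ s) (hsK : s * K ≤ 1 / 1000) :
    ContinuousOn (fun A : Fin n → Fin n → ℂ => fixedPoint s A) {A | ActBound A K} := by
  intro B hB
  set y := fixedPoint s B with hy
  rw [ContinuousWithinAt, tendsto_iff_norm_sub_tendsto_zero]
  have hbound : ∀ A ∈ {A : Fin n → Fin n → ℂ | ActBound A K},
      ‖fixedPoint s A - y‖ ≤ 2 * ((64 * s) * ‖act A y - act B y‖) := by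
    intro A hA
    have h := norm_fixedPoint_sub_le hA hK hs hsK (y := y) (norm_fixedPoint_apply_le s B)
    refine h.trans ?_
    gcongr
    have h2 : step s B 1 y = y := step_fixedPoint hB hK hs hsK
    nth_rewrite 2 [← h2]
    exact norm_le_of_forall_le (by positivity)
      fun j => norm_step_sub_step_apply_le hs A B y j
  have hlim : Filter.Tendsto (fun A : Fin n → Fin n → ℂ => 2 * ((64 * s) * ‖act A y - act B y‖))
      (nhdsWithin B {A | ActBound A K}) (nhds 0) := by
    have hc : Continuous fun A : Fin n → Fin n → ℂ => 2 * ((64 * s) * ‖act A y - act B y‖) := by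
      unfold act
      fun_prop
    have := (hc.tendsto B).mono_left (nhdsWithin_le_nhds (s := {A | ActBound A K}))
    simpa using this
  exact squeeze_zero' (Filter.Eventually.of_forall fun _ => norm_nonneg _)
    (Filter.eventually_of_mem self_mem_nhdsWithin hbound) hlim

/-- The matrix `A` with row and column `j` replaced by zero. -/
def eraseIndex (j : Fin n) (A : Fin n → Fin n → ℂ) : Fin n → Fin n → ℂ :=
  fun k l => if k = j ∨ l = j then 0 else A k l

lemma ActBound.eraseIndex {A : Fin n → Fin n → ℂ} {K : ℝ} (hA : ActBound A K) (hK : 0 ≤ K)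
    (j : Fin n) : ActBound (eraseIndex j A) K := by
  intro v
  let v' : PiLp 2 (fun _ : Fin n => ℂ) := WithLp.toLp 2 fun k => if k = j then 0 else v k
  have h1 : ‖act (PhaseSync.eraseIndex j A) v‖ ≤ 1 * ‖act A v'‖ := by
    refine norm_le_of_forall_le zero_le_one fun l => ?_
    by_cases hl : l = j
    · simp [PhaseSync.eraseIndex, hl]
    · have : act (PhaseSync.eraseIndex j A) v l = act A v' l := by
        simp only [act_apply]
        refine Finset.sum_congr rfl fun k _ => ?_
        by_cases hk : k = j <;> simp [PhaseSync.eraseIndex, hl, hk, v']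
      rw [this, one_mul]
  have h2 : ‖v'‖ ≤ 1 * ‖v‖ := by
    refine norm_le_of_forall_le zero_le_one fun l => ?_
    by_cases hl : l = j <;> simp [v', hl]
  have h3 := hA v'
  calc _ ≤ _ := h1
    _ ≤ K * (1 * ‖v‖) := by rw [one_mul]; exact h3.trans (by gcongr)
    _ = _ := by ring

/-- Erasing one index moves the fixed point by a bounded amount in the Euclidean norm, against a
norm of order `√n` of the fixed point itself. -/
lemma norm_fixedPoint_sub_eraseIndex_le {A : Fin n → Fin n → ℂ} {K s : ℝ}
    (hA : ActBound A K) (hK : 0 ≤ K) (hs : 0 ≤ s) (hsK : s * K ≤ 1 / 1000) (j : Fin n) :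
    ‖fixedPoint s A - fixedPoint s (eraseIndex j A)‖ ≤ 6 := by
  set B := eraseIndex j A with hB
  set y := fixedPoint s B with hy
  have hy1 : ∀ l, ‖y l‖ ≤ 1 := norm_fixedPoint_apply_le s B
  have h := norm_fixedPoint_sub_le hA hK hs hsK hy1
  have hyB : step s B 1 y = y := step_fixedPoint (hA.eraseIndex hK j) hK hs hsK
  let u : PiLp 2 (fun _ : Fin n => ℂ) := EuclideanSpace.single j (y j)
  have hact : ∀ l, l ≠ j → act A y l - act B y l = act A u l := by
    intro l hl
    simp only [act_apply, ← Finset.sum_sub_distrib]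
    refine Finset.sum_congr rfl fun k _ => ?_
    by_cases hk : k = j
    · subst hk; simp [hB, eraseIndex, u]
    · simp [hB, eraseIndex, hl, hk, u]
  -- coordinate `j` is bounded trivially, the others only see the erased row of `A`
  have hterm : ∀ l, ‖step s A 1 y l - step s B 1 y l‖ ^ 2 ≤
      (if l = j then 4 else 0) + (64 * s) ^ 2 * ‖act A u l‖ ^ 2 := by
    intro l
    by_cases hl : l = j
    · have h2 : ‖step s A 1 y l - step s B 1 y l‖ ≤ 2 := by
        refine (norm_sub_le _ _).trans ?_
        linarith [norm_step_apply_le s A 1 y l, norm_step_apply_le s B 1 y l]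
      have h4 : ‖step s A 1 y l - step s B 1 y l‖ ^ 2 ≤ 2 ^ 2 :=
        pow_le_pow_left₀ (norm_nonneg _) h2 2
      rw [if_pos hl]
      have : 0 ≤ (64 * s) ^ 2 * ‖act A u l‖ ^ 2 := by positivity
      linarith
    · have h2 := norm_step_sub_step_apply_le hs A B y l
      rw [hact l hl] at h2
      have h4 := pow_le_pow_left₀ (norm_nonneg _) h2 2
      rw [mul_pow] at h4
      rw [if_neg hl]
      linarith
  have hu : ‖u‖ ≤ 1 := by
    simpa [u] using hy1 j
  have hsum : ‖step s A 1 y - y‖ ^ 2 ≤ 9 := by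
    nth_rewrite 2 [← hyB]
    rw [PiLp.norm_sq_eq_of_L2]
    calc _ ≤ ∑ l, ((if l = j then 4 else 0) + (64 * s) ^ 2 * ‖act A u l‖ ^ 2) :=
          Finset.sum_le_sum fun l _ => hterm l
      _ = 4 + (64 * s) ^ 2 * ‖act A u‖ ^ 2 := by
          rw [Finset.sum_add_distrib, ← Finset.mul_sum, PiLp.norm_sq_eq_of_L2]
          simp
      _ ≤ 4 + (64 * s) ^ 2 * (K * 1) ^ 2 := by
          gcongr
          exact (hA u).trans (by gcongr)
      _ = 4 + 4096 * (s * K) ^ 2 := by ring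
      _ ≤ 9 := by
          have : 0 ≤ s * K := by positivity
          nlinarith
  have h3 : ‖step s A 1 y - y‖ ≤ 3 := by
    nlinarith [norm_nonneg (step s A 1 y - y)]
  linarith

lemma norm_act_apply_le {A : Fin n → Fin n → ℂ} {K : ℝ} (hA : ActBound A K)
    (v : PiLp 2 (fun _ : Fin n => ℂ)) (j : Fin n) : ‖act A v j‖ ≤ K * ‖v‖ :=
  (PiLp.norm_apply_le (act A v) j).trans (hA v)

/-- Column `j` of the noise seen by the fixed point and by its leave-one-out version are of the
same size. -/
lemma mul_norm_act_fixedPoint_le {A : Fin n → Fin n → ℂ} {K s : ℝ}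
    (hA : ActBound A K) (hK : 0 ≤ K) (hs : 0 ≤ s) (hsK : s * K ≤ 1 / 1000) (j : Fin n) :
    s * ‖act A (fixedPoint s A) j‖ ≤
      s * ‖act A (fixedPoint s (eraseIndex j A)) j‖ + 1 / 16 := by
  have h := norm_fixedPoint_sub_eraseIndex_le hA hK hs hsK j
  have h1 := norm_act_apply_le hA (fixedPoint s A - fixedPoint s (eraseIndex j A)) j
  rw [act_sub, PiLp.sub_apply] at h1
  have h2 := norm_le_norm_add_norm_sub' (act A (fixedPoint s A) j)
    (act A (fixedPoint s (eraseIndex j A)) j)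
  calc s * ‖act A (fixedPoint s A) j‖
      ≤ s * (‖act A (fixedPoint s (eraseIndex j A)) j‖ + K * 6) := by
        gcongr
        refine h2.trans ?_
        gcongr
        exact h1.trans (by gcongr)
    _ = s * ‖act A (fixedPoint s (eraseIndex j A)) j‖ + 6 * (s * K) := by ring
    _ ≤ _ := by linarith

/-- The fixed point is close to the constant vector `1`, so its alignment is close to `1`. -/
lemma le_align_fixedPoint {A : Fin n → Fin n → ℂ} {K s : ℝ} (hn : 1 ≤ n)
    (hA : ActBound A K) (hK : 0 ≤ K) (hs : 0 ≤ s) (hsK : s * K ≤ 1 / 1000) :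
    13 / 14 ≤ align 1 (fixedPoint s A) := by
  have hn' : (0 : ℝ) < n := by exact_mod_cast hn
  set x := fixedPoint s A with hx
  have hx1 : ∀ j, ‖x j‖ ≤ 1 := norm_fixedPoint_apply_le s A
  let o : PiLp 2 (fun _ : Fin n => ℂ) := WithLp.toLp 2 fun _ => 1
  have hclip : clip (1 : ℂ) = 1 := by
    simpa using clip_smul_of_le (v := (1 : ℂ)) (by simp) (r := 1) (by norm_num)
  have hdist : ‖x - o‖ ≤ 64 * s * ‖act A x‖ := by
    refine norm_le_of_forall_le (by positivity) fun j => ?_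
    have hxj : x j = clip (drift s A 1 x j) := by
      conv_lhs => rw [hx, ← step_fixedPoint hA hK hs hsK]
      rfl
    rw [PiLp.sub_apply, hxj, show o j = clip (1 : ℂ) from hclip.symm]
    refine (norm_clip_sub_clip_le _ _).trans ?_
    have h := inv_max_half_le (align 1 x)
    have : drift s A 1 x j - 1 = ((s * (max (align 1 x) (1 / 2))⁻¹ : ℝ) : ℂ) • act A x j := by
      simp only [drift]; module
    rw [this, norm_smul, Complex.norm_real, Real.norm_of_nonneg (mul_nonneg hs h.1.le)]
    calc 32 * (s * (max (align 1 x) (1 / 2))⁻¹ * ‖act A x j‖)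
        ≤ 32 * (s * 2 * ‖act A x j‖) := by
          gcongr
          exact h.2
      _ = _ := by ring
  have h1 := abs_align_sub_le (e := (1 : ℂ)) (by simp) x o
  have ho : align 1 o = 1 := by
    simp [align, o, hn'.ne']
  have hsq : 0 < √(n : ℝ) := Real.sqrt_pos.2 hn'
  have h2 : √(n : ℝ) * |align 1 x - align 1 o| ≤ √n * (64 / 1000) := by
    calc _ ≤ 64 * s * (K * √n) := by
          refine h1.trans (hdist.trans ?_)
          gcongr
          exact (hA x).trans (by gcongr; exact norm_le_sqrt_card hx1)
      _ = 64 * (s * K) * √n := by ring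
      _ ≤ 64 * (1 / 1000) * √n := by gcongr
      _ = _ := by ring
  have h3 := le_of_mul_le_mul_left h2 hsq
  rw [ho] at h3
  have := (abs_le.1 h3).1
  linarith

variable {E : Type*} [NormedAddCommGroup E] [InnerProductSpace ℂ E]

/-- The rank-one matrix with columns `x j • e`. -/
noncomputable def rankOne (e : E) (x : PiLp 2 (fun _ : Fin n => ℂ)) : PiLp 2 (fun _ : Fin n => E) :=
  WithLp.toLp 2 fun j => x j • e

lemma drift_rankOne {e : E} (he : ‖e‖ = 1) (s : ℝ) (A : Fin n → Fin n → ℂ)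
    (x : PiLp 2 (fun _ : Fin n => ℂ)) (j : Fin n) :
    drift s A e (rankOne e x) j = drift s A 1 x j • e := by
  have h1 : align e (rankOne e x) = align 1 x := by
    simp [align, rankOne, inner_self_eq_norm_sq_to_K, he]
  have h2 : act A (rankOne e x) j = act A x j • e := by
    simp [rankOne, Finset.sum_smul, smul_smul]
  simp only [drift, h1, h2, add_smul, one_smul, smul_assoc]

/-- If the columns of `V` are unit vectors positively proportional to those of its drift in
direction `e`, then `V` is close to the rank-one matrix built from the regularized fixed point: up
to a contraction the two can differ only at columns with a large noise term. -/
lemma norm_sub_rankOne_sq_le [FiniteDimensional ℂ E] {A : Fin n → Fin n → ℂ} {K s : ℝ}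
    (hn : 1 ≤ n) (hA : ActBound A K) (hK : 0 ≤ K) (hs : 0 ≤ s) (hsK : s * K ≤ 1 / 1000)
    {e : E} (he : ‖e‖ = 1) {V : PiLp 2 (fun _ : Fin n => E)} (hV : ∀ j, ‖V j‖ = 1)
    (hfix : ∀ j, ∃ r : ℝ, 0 ≤ r ∧ drift s A e V j = (r : ℂ) • V j) :
    ‖V - rankOne e (fixedPoint s A)‖ ^ 2 ≤
      4 * ∑ j, if 13 / 16 < s * ‖act A (fixedPoint s A) j‖ then (1 : ℝ) else 0 := by
  set x := fixedPoint s A with hx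
  have hx1 : ∀ j, ‖x j‖ ≤ 1 := norm_fixedPoint_apply_le s A
  set U := rankOne e x with hU
  have hU1 : ∀ j, ‖U j‖ ≤ 1 := fun j => by simpa [hU, rankOne, norm_smul, he] using hx1 j
  have hUfix : ∀ j, U j = clip (drift s A e U j) := by
    intro j
    rw [hU, drift_rankOne he, clip_smul_of_norm_one he]
    change x j • e = _
    congr 1
    conv_lhs => rw [hx, ← step_fixedPoint hA hK hs hsK]
    rfl
  have hal : 13 / 14 ≤ align 1 x := le_align_fixedPoint hn hA hK hs hsK
  -- at a column with small noise, the drift of the rank-one matrix stays away from the region of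
  -- radius `1 / 16` where `clip` differs from the normalization
  have hsmall : ∀ j, ¬ 13 / 16 < s * ‖act A x j‖ → 1 / 8 ≤ ‖drift s A e U j‖ := by
    intro j hj
    rw [hU, drift_rankOne he, norm_smul, he, mul_one]
    have hmax : max (align 1 x) (1 / 2) = align 1 x := max_eq_left (by linarith)
    have hinv : (align 1 x)⁻¹ ≤ 14 / 13 := by
      rw [inv_le_comm₀ (by linarith) (by norm_num)]; linarith
    have hinv0 : 0 < (align 1 x)⁻¹ := inv_pos.2 (by linarith)
    simp only [drift, hmax]
    have h1 : ‖((s * (align 1 x)⁻¹ : ℝ) : ℂ) • act A x j‖ ≤ 7 / 8 := by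
      rw [norm_smul, Complex.norm_real, Real.norm_of_nonneg (by positivity)]
      calc s * (align 1 x)⁻¹ * ‖act A x j‖ = (align 1 x)⁻¹ * (s * ‖act A x j‖) := by ring
        _ ≤ 14 / 13 * (13 / 16) := by
            gcongr
            exact not_lt.1 hj
        _ = 7 / 8 := by norm_num
    have h2 := norm_sub_le_norm_add (1 : ℂ) (((s * (align 1 x)⁻¹ : ℝ) : ℂ) • act A x j)
    rw [norm_one] at h2
    linarith
  have hterm : ∀ j, ‖(V - U) j‖ ≤ (if 13 / 16 < s * ‖act A x j‖ then 1 else 0) +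
      48 * ‖(drift s A e V - drift s A e U) j‖ := by
    intro j
    obtain ⟨r, hr0, hr⟩ := hfix j
    have hlip := norm_clip_sub_clip_le (drift s A e V j) (drift s A e U j)
    have htri := norm_sub_le_norm_sub_add_norm_sub (V j) (clip (drift s A e V j)) (U j)
    rw [← hUfix j] at hlip
    rw [PiLp.sub_apply, PiLp.sub_apply]
    have hnn := norm_nonneg (drift s A e V j - drift s A e U j)
    rcases le_total (1 / 16) r with h | h
    · have h0 : ‖V j - clip (drift s A e V j)‖ = 0 := by
        rw [hr, clip_smul_of_le (hV j) h, sub_self, norm_zero]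
      split_ifs <;> linarith
    -- otherwise either the column is counted, or the two drifts are at distance at least `1 / 16`
    · have h1 : ‖V j - clip (drift s A e V j)‖ ≤ 1 := by
        rw [hr]; exact norm_sub_clip_smul_le (hV j) hr0 h
      split_ifs with hj
      · linarith
      · have h2 : ‖drift s A e V j‖ = r := by
          rw [hr, norm_smul, hV j, Complex.norm_real, mul_one, Real.norm_of_nonneg hr0]
        have h3 := hsmall j hj
        have h4 := norm_sub_norm_le (drift s A e U j) (drift s A e V j)
        rw [norm_sub_rev] at h4
        linarith
  have hdrift := norm_drift_sub_le hA hK hs he V hU1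
  have hsq : ‖V - U‖ ^ 2 ≤ 2 * (∑ j, if 13 / 16 < s * ‖act A x j‖ then (1 : ℝ) else 0) +
      2 * 48 ^ 2 * ‖drift s A e V - drift s A e U‖ ^ 2 := by
    rw [PiLp.norm_sq_eq_of_L2, PiLp.norm_sq_eq_of_L2 _ (drift s A e V - drift s A e U),
      Finset.mul_sum, Finset.mul_sum, ← Finset.sum_add_distrib]
    refine Finset.sum_le_sum fun j _ => ?_
    have h1 := pow_le_pow_left₀ (norm_nonneg _) (hterm j) 2
    refine h1.trans (add_sq_le.trans (le_of_eq ?_))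
    split_ifs <;> ring
  have hd2 : ‖drift s A e V - drift s A e U‖ ^ 2 ≤ (6 / 1000) ^ 2 * ‖V - U‖ ^ 2 := by
    rw [← mul_pow]
    refine pow_le_pow_left₀ (norm_nonneg _) (hdrift.trans ?_) 2
    gcongr
    linarith
  nlinarith [sq_nonneg ‖V - U‖]

end FixedPoint

/-! ### First-order conditions for the optimizers, and the change of gauge -/

section Optimizers

variable {n : ℕ} {E : Type*} [NormedAddCommGroup E] [InnerProductSpace ℂ E]

/-- The value `Re ⟨V Y, V⟩` of the quadratic program at `V`. -/
noncomputable def quad (Y : Fin n → Fin n → ℂ) (V : PiLp 2 (fun _ : Fin n => E)) : ℝ :=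
  (inner ℂ (act Y V) V).re

lemma re_inner_self_eq_norm_sq (x : E) : (inner ℂ x x).re = ‖x‖ ^ 2 :=
  inner_self_eq_norm_sq (𝕜 := ℂ) x

lemma inner_act_right {Y : Fin n → Fin n → ℂ} (hY : ∀ j k, star (Y j k) = Y k j)
    (V U : PiLp 2 (fun _ : Fin n => E)) : inner ℂ (act Y V) U = inner ℂ V (act Y U) := by
  simp only [PiLp.inner_apply, act_apply, sum_inner, inner_sum, inner_smul_left, inner_smul_right]
  rw [Finset.sum_comm]
  refine Finset.sum_congr rfl fun j _ => Finset.sum_congr rfl fun k _ => ?_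
  rw [← hY k j, starRingEnd_apply, star_star]

lemma act_add (A : Fin n → Fin n → ℂ) (V U : PiLp 2 (fun _ : Fin n => E)) :
    act A (V + U) = act A V + act A U := by
  ext j
  simp [act, smul_add, Finset.sum_add_distrib]

/-- First-order condition: at a maximizer of the quadratic program over unit columns, each column
is the normalization of the corresponding column of `V Y`. -/
lemma exists_act_apply_eq_smul {Y : Fin n → Fin n → ℂ} (hY : ∀ j k, star (Y j k) = Y k j)
    (hdiag : ∀ j, Y j j = 1) {V : PiLp 2 (fun _ : Fin n => E)} (hV : ∀ j, ‖V j‖ = 1)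
    (hmax : ∀ U : PiLp 2 (fun _ : Fin n => E), (∀ j, ‖U j‖ = 1) → quad Y U ≤ quad Y V)
    (j : Fin n) : ∃ r : ℝ, 0 ≤ r ∧ act Y V j = (r : ℂ) • V j := by
  set g := act Y V j - V j with hg
  -- replacing column `j` by a unit vector `u` cannot increase the objective
  have key : ∀ u : E, ‖u‖ = 1 → (inner ℂ g u).re ≤ (inner ℂ g (V j)).re := by
    intro u hu
    let D : PiLp 2 (fun _ : Fin n => E) := WithLp.toLp 2 (Pi.single j (u - V j))
    have hD : ∀ l, D l = if l = j then u - V j else 0 := fun l => by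
      simp [D, Pi.single_apply]
    have hU : ∀ l, ‖(V + D) l‖ = 1 := by
      intro l
      rw [PiLp.add_apply, hD]
      split_ifs with h
      · rw [h, add_sub_cancel, hu]
      · rw [add_zero, hV]
    have h1 := hmax _ hU
    have h2 : (inner ℂ (act Y V) D : ℂ) = inner ℂ (act Y V j) (u - V j) := by
      rw [PiLp.inner_apply, Finset.sum_eq_single j]
      · rw [hD, if_pos rfl]
      · intro l _ hl
        rw [hD, if_neg hl, inner_zero_right]
      · simp
    have h3 : (inner ℂ (act Y D) D : ℂ) = inner ℂ (u - V j) (u - V j) := by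
      rw [PiLp.inner_apply, Finset.sum_eq_single j]
      · rw [act_apply, Finset.sum_eq_single j]
        · rw [hD, if_pos rfl, hdiag, one_smul]
        · intro l _ hl
          rw [hD, if_neg hl, smul_zero]
        · simp
      · intro l _ hl
        rw [hD, if_neg hl, inner_zero_right]
      · simp
    have h4 : (inner ℂ (act Y D) V).re = (inner ℂ (act Y V) D).re := by
      rw [inner_act_right hY, ← inner_conj_symm, Complex.conj_re]
    have h5 : quad Y (V + D) = quad Y V + 2 * (inner ℂ (act Y V j) (u - V j)).re +
        (inner ℂ (u - V j) (u - V j)).re := by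
      simp only [quad, act_add, inner_add_left, inner_add_right, Complex.add_re, h4, h2, h3]
      ring
    have h6 : (inner ℂ (u - V j) (u - V j)).re = 2 - 2 * (inner ℂ (V j) u).re := by
      have hc : (inner ℂ u (V j)).re = (inner ℂ (V j) u).re := by
        rw [← inner_conj_symm, Complex.conj_re]
      simp only [inner_sub_left, inner_sub_right, Complex.sub_re, hc,
        re_inner_self_eq_norm_sq, hu, hV]
      ring
    have h7 : (inner ℂ (V j) (V j)).re = 1 := by
      simp [hV]
    rw [h5, h6] at h1
    simp only [hg, inner_sub_left, inner_sub_right, Complex.sub_re, h7] at h1 ⊢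
    linarith
  refine ⟨1 + ‖g‖, by positivity, ?_⟩
  have hgV : g = (‖g‖ : ℂ) • V j := by
    by_cases hg0 : g = 0
    · simp [hg0]
    have hgn : 0 < ‖g‖ := norm_pos_iff.2 hg0
    have h1 := key (((‖g‖⁻¹ : ℝ) : ℂ) • g) (by
      rw [norm_smul, Complex.norm_real, norm_inv, norm_norm, inv_mul_cancel₀ hgn.ne'])
    have h2 : (inner ℂ g (((‖g‖⁻¹ : ℝ) : ℂ) • g)).re = ‖g‖ := by
      rw [inner_smul_right, Complex.re_ofReal_mul, re_inner_self_eq_norm_sq, sq,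
        inv_mul_cancel_left₀ hgn.ne']
    rw [h2] at h1
    have h3 : ‖inner ℂ g (V j)‖ ≤ ‖g‖ := by
      simpa [hV] using norm_inner_le_norm (𝕜 := ℂ) g (V j)
    have h4 : inner ℂ g (V j) = (‖g‖ : ℂ) * (‖V j‖ : ℂ) := by
      rw [hV, Complex.ofReal_one, mul_one]
      have hre : (inner ℂ g (V j)).re = ‖g‖ :=
        le_antisymm ((Complex.re_le_norm _).trans h3) h1
      have hn : ‖inner ℂ g (V j)‖ = (inner ℂ g (V j)).re :=
        le_antisymm (h3.trans hre.ge) (Complex.re_le_norm _)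
      have h0 : (inner ℂ g (V j)).im = 0 := by
        have := Complex.sq_norm (inner ℂ g (V j))
        rw [hn, Complex.normSq_apply] at this
        nlinarith
      exact Complex.ext (by simpa using hre) (by simpa using h0)
    have h5 := inner_eq_norm_mul_iff.1 h4
    simpa [hV] using h5
  have : act Y V j = g + V j := by rw [hg, sub_add_cancel]
  rw [this]
  conv_lhs => rw [hgV]
  push_cast
  module

/-- The columns of a maximizer for `Y = 1 1ᵀ + σ A` are positively proportional to those of its
drift in the direction `e` of their mean. -/
lemma exists_drift_eq_smul [FiniteDimensional ℂ E] (hn : 1 ≤ n) {A : Fin n → Fin n → ℂ}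
    {K σ : ℝ} (hA : ActBound A K) (hK : 0 ≤ K) (hσ : 0 ≤ σ) (hsK : σ / n * K ≤ 1 / 1000)
    (hherm : ∀ j k, star (A j k) = A k j) (hdiag : ∀ j, A j j = 0)
    {V : PiLp 2 (fun _ : Fin n => E)} (hV : ∀ j, ‖V j‖ = 1)
    (hmax : ∀ U : PiLp 2 (fun _ : Fin n => E), (∀ j, ‖U j‖ = 1) →
      quad (fun j k => 1 + (σ : ℂ) * A j k) U ≤ quad (fun j k => 1 + (σ : ℂ) * A j k) V) :
    ∃ e : E, ‖e‖ = 1 ∧ ∀ j, ∃ r : ℝ, 0 ≤ r ∧ drift (σ / n) A e V j = (r : ℂ) • V j := by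
  have hn' : (0 : ℝ) < n := by exact_mod_cast hn
  set Y : Fin n → Fin n → ℂ := fun j k => 1 + (σ : ℂ) * A j k with hYdef
  have hact : ∀ (U : PiLp 2 (fun _ : Fin n => E)) j,
      act Y U j = ∑ k, U k + (σ : ℂ) • act A U j := by
    intro U j
    simp [Y, add_smul, Finset.sum_add_distrib, Finset.smul_sum, smul_smul]
  have hquad : ∀ U : PiLp 2 (fun _ : Fin n => E),
      quad Y U = ‖∑ k, U k‖ ^ 2 + σ * (inner ℂ (act A U) U).re := by
    intro U
    have : inner ℂ (act Y U) U = inner ℂ (∑ k, U k) (∑ k, U k) + (σ : ℂ) * inner ℂ (act A U) U := by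
      rw [PiLp.inner_apply, PiLp.inner_apply, inner_sum, Finset.mul_sum, ← Finset.sum_add_distrib]
      refine Finset.sum_congr rfl fun j _ => ?_
      rw [hact, inner_add_left, inner_smul_left, Complex.conj_ofReal]
    rw [quad, this, Complex.add_re, Complex.re_ofReal_mul, re_inner_self_eq_norm_sq]
  have hnoise : ∀ U : PiLp 2 (fun _ : Fin n => E), (∀ j, ‖U j‖ = 1) →
      |(inner ℂ (act A U) U).re| ≤ K * n := by
    intro U hU
    have h1 := norm_sq_le_card (fun j => (hU j).le)
    calc |(inner ℂ (act A U) U).re| ≤ ‖act A U‖ * ‖U‖ :=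
          (Complex.abs_re_le_norm _).trans (norm_inner_le_norm _ _)
      _ ≤ (K * ‖U‖) * ‖U‖ := by gcongr; exact hA.norm_act_le hK U
      _ = K * ‖U‖ ^ 2 := by ring
      _ ≤ K * n := by gcongr
  set S := ∑ k, V k with hS
  -- comparison with a constant competitor shows that the columns of `V` are nearly aligned
  have hSn : (n : ℝ) ^ 2 * (1 / 4) ≤ ‖S‖ ^ 2 := by
    let U : PiLp 2 (fun _ : Fin n => E) := WithLp.toLp 2 fun _ => V ⟨0, hn⟩
    have hU : ∀ j, ‖U j‖ = 1 := fun j => hV _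
    have h1 := hmax U hU
    rw [hquad, hquad] at h1
    have h2 : ‖∑ k, U k‖ = n := by
      simp only [U, Finset.sum_const, Finset.card_univ, Fintype.card_fin]
      rw [← Nat.cast_smul_eq_nsmul ℂ, norm_smul, hV]
      simp
    rw [h2] at h1
    have h3 := abs_le.1 (hnoise U hU)
    have h4 := abs_le.1 (hnoise V hV)
    have h5 : σ * (inner ℂ (act A V) V).re ≤ σ * (K * n) := by gcongr; exact h4.2
    have h6 : σ * (-(K * n)) ≤ σ * (inner ℂ (act A U) U).re := by gcongr; exact h3.1
    have h7 : σ * (K * n) = σ / n * K * n ^ 2 := by field_simp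
    have h8 : σ / n * K * n ^ 2 ≤ 1 / 1000 * n ^ 2 := by gcongr
    nlinarith
  have hSpos : (n : ℝ) / 2 ≤ ‖S‖ := by
    refine le_of_sq_le_sq ?_ (norm_nonneg _)
    linarith [show ((n : ℝ) / 2) ^ 2 = n ^ 2 * (1 / 4) by ring]
  have hS0 : 0 < ‖S‖ := by linarith [half_pos hn']
  refine ⟨((‖S‖⁻¹ : ℝ) : ℂ) • S, ?_, fun j => ?_⟩
  · rw [norm_smul, Complex.norm_real, norm_inv, norm_norm, inv_mul_cancel₀ hS0.ne']
  have hal : align (((‖S‖⁻¹ : ℝ) : ℂ) • S) V = ‖S‖ / n := by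
    rw [align, ← Complex.re_sum, ← inner_sum, ← hS, inner_smul_left, Complex.conj_ofReal,
      Complex.re_ofReal_mul, re_inner_self_eq_norm_sq, sq,
      inv_mul_cancel_left₀ hS0.ne']
  have hmax' : max (‖S‖ / n) (1 / 2) = ‖S‖ / n := by
    refine max_eq_left ?_
    rw [le_div_iff₀ hn']; linarith
  have hYherm : ∀ j k, star (Y j k) = Y k j := by
    intro j k
    rw [hYdef]
    simp only [star_add, star_one, star_mul', hherm]
    simp
  obtain ⟨r, hr0, hr⟩ := exists_act_apply_eq_smul hYherm (fun j => by simp [Y, hdiag]) hV hmax j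
  refine ⟨‖S‖⁻¹ * r, by positivity, ?_⟩
  have hr' : S + (σ : ℂ) • act A V j = (r : ℂ) • V j := by rw [hS, ← hact, hr]
  have hc : σ / n * (‖S‖ / n)⁻¹ = ‖S‖⁻¹ * σ := by field_simp
  simp only [drift, hal, hmax', hc]
  rw [Complex.ofReal_mul, Complex.ofReal_mul, mul_smul, mul_smul, ← hr', smul_add]

end Optimizers

section Gauge

variable {n m : ℕ}

/-- The noise matrix conjugated by the diagonal matrix of the phases `z`, which reduces the
problem to the signal `1 1ᵀ`. -/
noncomputable def gauge (z : Fin n → ℂ) (W : Fin n → Fin n → ℂ) : Fin n → Fin n → ℂ :=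
  fun k j => star (z k) * W k j * z j

/-- The columns of `V`, rotated by the phases `z`. -/
noncomputable def gaugeCols (z : Fin n → ℂ) (V : Matrix (Fin m) (Fin n) ℂ) :
    PiLp 2 (fun _ : Fin n => EuclideanSpace ℂ (Fin m)) :=
  WithLp.toLp 2 fun j => WithLp.toLp 2 fun i => z j * V i j

lemma star_mul_self_of_mem_phases {z : Fin n → ℂ} (hz : z ∈ phases n) (j : Fin n) :
    star (z j) * z j = 1 := by
  change starRingEnd ℂ (z j) * z j = 1
  rw [Complex.conj_mul', hz j]
  simp

lemma mul_star_self_of_mem_phases {z : Fin n → ℂ} (hz : z ∈ phases n) (j : Fin n) :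
    z j * star (z j) = 1 := by
  rw [mul_comm, star_mul_self_of_mem_phases hz]

lemma norm_gaugeCols {z : Fin n → ℂ} (hz : z ∈ phases n) {V : Matrix (Fin m) (Fin n) ℂ}
    (hV : V ∈ unitCols m n) (j : Fin n) : ‖gaugeCols z V j‖ = 1 := by
  have h : ‖gaugeCols z V j‖ ^ 2 = 1 := by
    rw [EuclideanSpace.norm_sq_eq]
    simpa [gaugeCols, hz j] using hV j
  exact (pow_eq_one_iff_of_nonneg (norm_nonneg _) two_ne_zero).1 h

lemma quad_gaugeCols {z : Fin n → ℂ} (hz : z ∈ phases n) (σ : ℝ) {W : Matrix (Fin n) (Fin n) ℂ}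
    (hW : W.IsHermitian) (V : Matrix (Fin m) (Fin n) ℂ) :
    quad (fun j k => 1 + (σ : ℂ) * gauge z W j k) (gaugeCols z V) =
      frobInner (obs σ z W) (Vᴴ * V) := by
  have hherm : (obs σ z W)ᴴ = obs σ z W := by
    rw [obs, conjTranspose_add, conjTranspose_smul, hW.eq, conjTranspose_vecMulVec]
    simp
  rw [quad, frobInner, hherm, Matrix.trace]
  congr 1
  simp only [PiLp.inner_apply, act_apply, sum_inner, inner_smul_left, Matrix.diag_apply,
    Matrix.mul_apply, Finset.mul_sum, gaugeCols, RCLike.inner_apply, Matrix.conjTranspose_apply]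
  refine Finset.sum_congr rfl fun j _ => Finset.sum_congr rfl fun k _ =>
    Finset.sum_congr rfl fun i _ => ?_
  have hσ : star (σ : ℂ) = σ := Complex.conj_ofReal σ
  have hWjk : W j k = star (W k j) := (hW.apply j k).symm
  have hk := star_mul_self_of_mem_phases hz k
  have hj := mul_star_self_of_mem_phases hz j
  simp only [obs, gauge, Matrix.add_apply, Matrix.smul_apply, vecMulVec_apply, hWjk, Pi.star_apply,
    map_add, map_mul, map_one, smul_eq_mul, starRingEnd_apply, star_star, hσ]
  linear_combination (σ * star (W k j) * V i j * star (V i k)) * (z j * star (z j) * hk + hj)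

end Gauge

/-! ### Deterministic comparison of the two optimizers -/

section Comparison

variable {n m : ℕ}

lemma star_gauge {z : Fin n → ℂ} {W : Matrix (Fin n) (Fin n) ℂ} (hW : W.IsHermitian)
    (j k : Fin n) : star (gauge z W j k) = gauge z W k j := by
  have hWjk : W j k = star (W k j) := (hW.apply j k).symm
  simp only [gauge, star_mul, star_star, hWjk]
  ring

lemma actBound_gauge {z : Fin n → ℂ} (hz : z ∈ phases n) {W : Matrix (Fin n) (Fin n) ℂ}
    (hW : W.IsHermitian) {K : ℝ} (hK : opNorm W ≤ K) : ActBound (gauge z W) K := by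
  intro v
  let u : EuclideanSpace ℂ (Fin n) := WithLp.toLp 2 fun k => z k * star (v k)
  have h1 : ‖act (gauge z W) v‖ ≤ 1 * ‖Matrix.toEuclideanCLM (n := Fin n) (𝕜 := ℂ) W u‖ := by
    refine norm_le_of_forall_le zero_le_one fun j => ?_
    have : act (gauge z W) v j =
        z j * star ((Matrix.toEuclideanCLM (n := Fin n) (𝕜 := ℂ) W u) j) := by
      rw [act_apply, Matrix.ofLp_toEuclideanCLM, Matrix.mulVec, dotProduct, star_sum,
        Finset.mul_sum]
      refine Finset.sum_congr rfl fun k _ => ?_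
      rw [← hW.apply j k]
      simp only [gauge, u, star_mul, star_star, smul_eq_mul]
      ring
    rw [this, norm_mul, hz j, norm_star]
  have h2 : ‖u‖ ≤ 1 * ‖v‖ := by
    refine norm_le_of_forall_le zero_le_one fun j => ?_
    simp [u, hz j]
  rw [one_mul] at h1 h2
  exact h1.trans ((ContinuousLinearMap.le_opNorm _ _).trans
    (mul_le_mul hK h2 (norm_nonneg _) ((norm_nonneg _).trans hK)))

/-- Solutions of the Burer-Monteiro problem are, up to gauge, close to a rank-one matrix with
coefficients that depend on the noise only. -/
lemma IsBM.exists_norm_gaugeCols_sub_le (hn : 1 ≤ n) {z : Fin n → ℂ} (hz : z ∈ phases n)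
    {W : Matrix (Fin n) (Fin n) ℂ} (hW : W.IsHermitian) (hdiag : ∀ j, W j j = 0) {K σ : ℝ}
    (hK : opNorm W ≤ K) (hσ : 0 ≤ σ) (hsK : σ / n * K ≤ 1 / 1000)
    {V : Matrix (Fin m) (Fin n) ℂ} (hV : IsBM (obs σ z W) V) :
    ∃ e : EuclideanSpace ℂ (Fin m), ‖e‖ = 1 ∧
      ‖gaugeCols z V - rankOne e (fixedPoint (σ / n) (gauge z W))‖ ^ 2 ≤
      4 * ∑ j, if 13 / 16 < σ / n * ‖act (gauge z W) (fixedPoint (σ / n) (gauge z W)) j‖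
        then (1 : ℝ) else 0 := by
  have hK0 : 0 ≤ K := (norm_nonneg _).trans hK
  have hA := actBound_gauge hz hW hK
  have hV1 := norm_gaugeCols hz hV.1
  have hmax : ∀ U : PiLp 2 (fun _ : Fin n => EuclideanSpace ℂ (Fin m)), (∀ j, ‖U j‖ = 1) →
      quad (fun j k => 1 + (σ : ℂ) * gauge z W j k) U ≤
        quad (fun j k => 1 + (σ : ℂ) * gauge z W j k) (gaugeCols z V) := by
    intro U hU
    let X : Matrix (Fin m) (Fin n) ℂ := fun i j => star (z j) * U j i
    have hX : gaugeCols z X = U := by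
      ext j i
      change z j * (star (z j) * U j i) = U j i
      rw [← mul_assoc, mul_star_self_of_mem_phases hz, one_mul]
    have hXmem : X ∈ unitCols m n := by
      intro j
      have := EuclideanSpace.norm_sq_eq (U j)
      rw [hU j, one_pow] at this
      simp [X, hz j, ← this]
    rw [← hX, quad_gaugeCols hz σ hW, quad_gaugeCols hz σ hW]
    exact hV.2 hXmem
  obtain ⟨e, he, hfix⟩ := exists_drift_eq_smul hn hA hK0 hσ hsK (star_gauge hW)
    (fun j => by simp [gauge, hdiag]) hV1 hmax
  exact ⟨e, he, norm_sub_rankOne_sq_le hn hA hK0 (by positivity) hsK he hV1 hfix⟩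

/-- A maximum likelihood estimate is, after conjugation, a Burer-Monteiro solution with one row. -/
lemma IsMLE.isBM {Y : Matrix (Fin n) (Fin n) ℂ} {z : Fin n → ℂ} (hz : IsMLE Y z) :
    IsBM Y (Matrix.of fun (_ : Fin 1) j => star (z j)) := by
  have hrow : ∀ x : Fin n → ℂ, (Matrix.of fun (_ : Fin 1) j => star (x j))ᴴ *
      (Matrix.of fun (_ : Fin 1) j => star (x j)) = vecMulVec x (star x) := by
    intro x
    ext j k
    simp [Matrix.mul_apply, vecMulVec_apply]
  refine ⟨fun j => by simp [hz.1 j], fun X hX => ?_⟩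
  have hXrow : X = Matrix.of fun (_ : Fin 1) j => star (star (X 0 j)) := by
    ext i j
    simp [Subsingleton.elim i 0]
  have hmem : (fun j => star (X 0 j)) ∈ phases n := by
    intro j
    have h := hX j
    rw [Fin.sum_univ_one] at h
    rw [norm_star]
    exact (pow_eq_one_iff_of_nonneg (norm_nonneg _) two_ne_zero).1 h
  have h := hz.2 hmem
  simp only [Set.mem_ofPred_eq] at h ⊢
  rw [hrow, hXrow, hrow fun j => star (X 0 j)]
  exact h

lemma bddBelow_range_loss (V : Matrix (Fin m) (Fin n) ℂ) (z : Fin n → ℂ) :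
    BddBelow (Set.range fun a : Metric.sphere (0 : EuclideanSpace ℂ (Fin m)) 1 =>
      (1 / (n : ℝ)) * ∑ i, ∑ j, ‖V i j - a.1 i * star (z j)‖ ^ 2) :=
  ⟨0, by rintro _ ⟨a, rfl⟩; positivity⟩

lemma loss_nonneg (V : Matrix (Fin m) (Fin n) ℂ) (z : Fin n → ℂ) : 0 ≤ loss V z :=
  Real.iInf_nonneg fun _ => by positivity

/-- After rotation by the phases `zs`, the loss is bounded by the distance of the columns to any
rank-one matrix with coefficients `zs j * star (z j)`. -/
lemma loss_le_norm_sub_sq {zs : Fin n → ℂ} (hzs : zs ∈ phases n)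
    (V : Matrix (Fin m) (Fin n) ℂ) (z : Fin n → ℂ) {a : EuclideanSpace ℂ (Fin m)} (ha : ‖a‖ = 1) :
    loss V z ≤
      1 / n * ‖gaugeCols zs V - rankOne a (WithLp.toLp 2 fun j => zs j * star (z j))‖ ^ 2 := by
  refine (ciInf_le (bddBelow_range_loss V z) ⟨a, by simpa using ha⟩).trans (le_of_eq ?_)
  rw [PiLp.norm_sq_eq_of_L2, Finset.sum_comm]
  congr 1
  refine Finset.sum_congr rfl fun j _ => ?_
  rw [EuclideanSpace.norm_sq_eq]
  refine Finset.sum_congr rfl fun i _ => ?_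
  have : (gaugeCols zs V - rankOne a (WithLp.toLp 2 fun j => zs j * star (z j))) j i =
      zs j * (V i j - a i * star (z j)) := by
    simp only [gaugeCols, rankOne, PiLp.sub_apply, PiLp.smul_apply, smul_eq_mul]
    ring
  rw [this, norm_mul, hzs j, one_mul]

/-- The loss is always at most `4` on feasible points. -/
lemma loss_le_four (hm : 1 ≤ m) {V : Matrix (Fin m) (Fin n) ℂ} (hV : V ∈ unitCols m n)
    {z : Fin n → ℂ} (hz : z ∈ phases n) : loss V z ≤ 4 := by
  let a : EuclideanSpace ℂ (Fin m) := EuclideanSpace.single ⟨0, hm⟩ 1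
  have ha : ‖a‖ = 1 := by simp [a]
  have hone : (1 : Fin n → ℂ) ∈ phases n := fun j => by simp
  refine (loss_le_norm_sub_sq hone V z ha).trans ?_
  have h1 := norm_le_sqrt_card (fun j => (norm_gaugeCols hone hV j).le)
  have h2 := norm_le_sqrt_card
    (x := rankOne a (WithLp.toLp 2 fun j => (1 : Fin n → ℂ) j * star (z j)))
    (fun j => by simp [rankOne, norm_smul, ha, hz j])
  have h3 := (norm_sub_le (gaugeCols 1 V)
    (rankOne a (WithLp.toLp 2 fun j => (1 : Fin n → ℂ) j * star (z j)))).trans (add_le_add h1 h2)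
  have h4 := pow_le_pow_left₀ (norm_nonneg _) h3 2
  have h5 : (√(n : ℝ) + √n) ^ 2 = 4 * n := by
    rw [← two_mul, mul_pow, Real.sq_sqrt (Nat.cast_nonneg n)]; norm_num
  rw [h5] at h4
  rcases Nat.eq_zero_or_pos n with rfl | hn
  · simp
  have hn' : (0 : ℝ) < n := by exact_mod_cast hn
  rw [one_div, inv_mul_le_iff₀ hn']
  linarith

/-- Both optimizers are close to the same rank-one matrix, hence to each other. -/
lemma loss_le_card (hn : 1 ≤ n) {zs : Fin n → ℂ} (hzs : zs ∈ phases n)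
    {W : Matrix (Fin n) (Fin n) ℂ} (hW : W.IsHermitian) (hdiag : ∀ j, W j j = 0) {K σ : ℝ}
    (hK : opNorm W ≤ K) (hσ : 0 ≤ σ) (hsK : σ / n * K ≤ 1 / 1000)
    {V : Matrix (Fin m) (Fin n) ℂ} (hV : IsBM (obs σ zs W) V)
    {z : Fin n → ℂ} (hz : IsMLE (obs σ zs W) z) :
    loss V z ≤ 16 / n *
      ∑ j, if 13 / 16 < σ / n * ‖act (gauge zs W) (fixedPoint (σ / n) (gauge zs W)) j‖
        then (1 : ℝ) else 0 := by
  obtain ⟨e, he, h1⟩ := hV.exists_norm_gaugeCols_sub_le hn hzs hW hdiag hK hσ hsK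
  obtain ⟨f, hf, h2⟩ := hz.isBM.exists_norm_gaugeCols_sub_le hn hzs hW hdiag hK hσ hsK
  set x := fixedPoint (σ / n) (gauge zs W) with hx
  set B : ℝ := ∑ j, if 13 / 16 < σ / n * ‖act (gauge zs W) x j‖ then (1 : ℝ) else 0
  set U := gaugeCols zs (Matrix.of fun (_ : Fin 1) j => star (z j)) with hU
  set y : PiLp 2 (fun _ : Fin n => ℂ) := WithLp.toLp 2 fun j => zs j * star (z j) with hy
  have hf0 : ‖f 0‖ = 1 := by
    have h := EuclideanSpace.norm_sq_eq f
    rw [hf, Fin.sum_univ_one, one_pow] at h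
    exact (pow_eq_one_iff_of_nonneg (norm_nonneg _) two_ne_zero).1 h.symm
  have hff : star (f 0) * f 0 = 1 := by
    change starRingEnd ℂ (f 0) * f 0 = 1
    rw [Complex.conj_mul', hf0]
    simp
  have ha : ‖star (f 0) • e‖ = 1 := by rw [norm_smul, norm_star, hf0, he, one_mul]
  refine (loss_le_norm_sub_sq hzs V z ha).trans ?_
  have h3 : ‖rankOne e x - rankOne (star (f 0) • e) y‖ ≤ 1 * ‖U - rankOne f x‖ := by
    refine norm_le_of_forall_le zero_le_one fun j => ?_
    have hL : (rankOne e x - rankOne (star (f 0) • e) y) j =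
        (star (f 0) * (x j * f 0 - y j)) • e := by
      have : x j = star (f 0) * (x j * f 0) := by linear_combination (-x j) * hff
      rw [PiLp.sub_apply]
      change x j • e - y j • star (f 0) • e = _
      conv_lhs => rw [this]
      module
    have hR : ‖(U - rankOne f x) j‖ = ‖y j - x j * f 0‖ := by
      refine (sq_eq_sq₀ (norm_nonneg _) (norm_nonneg _)).1 ?_
      rw [EuclideanSpace.norm_sq_eq, Fin.sum_univ_one]
      rfl
    rw [hL, hR, norm_smul, he, norm_mul, norm_star, hf0, norm_sub_rev]
    linarith
  rw [one_mul] at h3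
  have h4 := norm_sub_le_norm_sub_add_norm_sub (gaugeCols zs V) (rankOne e x)
    (rankOne (star (f 0) • e) y)
  have h5 : ‖gaugeCols zs V - rankOne (star (f 0) • e) y‖ ^ 2 ≤ 16 * B := by
    calc _ ≤ (‖gaugeCols zs V - rankOne e x‖ + ‖U - rankOne f x‖) ^ 2 :=
          pow_le_pow_left₀ (norm_nonneg _) (h4.trans (by gcongr)) 2
      _ ≤ 2 * (‖gaugeCols zs V - rankOne e x‖ ^ 2 + ‖U - rankOne f x‖ ^ 2) := add_sq_le
      _ ≤ 2 * (4 * B + 4 * B) := by gcongr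
      _ = 16 * B := by ring
  calc 1 / (n : ℝ) * ‖gaugeCols zs V - rankOne (star (f 0) • e) y‖ ^ 2 ≤ 1 / n * (16 * B) := by
        gcongr
    _ = _ := by ring

/-- The leave-one-out coefficients by which row `j` of the noise is multiplied. They do not depend
on the entries of `W` with an index equal to `j`. -/
noncomputable def looWeights (s : ℝ) (z : Fin n → ℂ) (j : Fin n) (W : Fin n → Fin n → ℂ)
    (k : Fin n) : ℂ :=
  fixedPoint s (gauge z (eraseIndex j W)) k * star (z k)

lemma lt_mul_norm_sum_looWeights {zs : Fin n → ℂ} (hzs : zs ∈ phases n)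
    {W : Matrix (Fin n) (Fin n) ℂ} (hW : W.IsHermitian) {K s : ℝ}
    (hK : opNorm W ≤ K) (hs : 0 ≤ s) (hsK : s * K ≤ 1 / 1000) {j : Fin n}
    (hj : 13 / 16 < s * ‖act (gauge zs W) (fixedPoint s (gauge zs W)) j‖) :
    3 / 4 < s * ‖∑ k, looWeights s zs j W k * W k j‖ := by
  have h := mul_norm_act_fixedPoint_le (actBound_gauge hzs hW hK) ((norm_nonneg _).trans hK)
    hs hsK j
  have hg : gauge zs (eraseIndex j W) = eraseIndex j (gauge zs W) := by
    ext k l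
    simp only [gauge, eraseIndex]
    split_ifs <;> simp
  have h2 : ‖act (gauge zs W) (fixedPoint s (eraseIndex j (gauge zs W))) j‖ =
      ‖∑ k, looWeights s zs j W k * W k j‖ := by
    have : act (gauge zs W) (fixedPoint s (eraseIndex j (gauge zs W))) j =
        zs j * ∑ k, looWeights s zs j W k * W k j := by
      rw [act_apply, Finset.mul_sum]
      refine Finset.sum_congr rfl fun k _ => ?_
      simp only [looWeights, hg, gauge, smul_eq_mul]
      ring
    rw [this, norm_mul, hzs j, one_mul]
  rw [h2] at h
  linarith

end Comparison

/-! ### The law of the noise matrix and its exponential moments -/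

section Gaussian

open scoped ENNReal

instance : IsProbabilityMeasure stdComplexGaussian :=
  Measure.isProbabilityMeasure_map Complex.measurableEquivRealProd.symm.measurable.aemeasurable

lemma lintegral_exp_gaussianReal_half (a : ℝ) :
    ∫⁻ x, ENNReal.ofReal (Real.exp (a * x)) ∂(gaussianReal 0 (1 / 2)) =
      ENNReal.ofReal (Real.exp (a ^ 2 / 4)) := by
  rw [← ofReal_integral_eq_lintegral_ofReal (integrable_exp_mul_gaussianReal a)
    (Filter.Eventually.of_forall fun _ => (Real.exp_pos _).le)]
  congr 1
  have h := mgf_gaussianReal (p := gaussianReal 0 (1 / 2)) (X := id) Measure.map_id a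
  simp only [mgf, id] at h
  rw [h]
  congr 1
  push_cast
  ring

/-- The exponential moments of a real-linear functional of a standard complex Gaussian. -/
lemma lintegral_exp_stdComplexGaussian (c : ℂ) :
    ∫⁻ w, ENNReal.ofReal (Real.exp ((c * w).re)) ∂stdComplexGaussian =
      ENNReal.ofReal (Real.exp (‖c‖ ^ 2 / 4)) := by
  rw [stdComplexGaussian, lintegral_map_equiv]
  have h : ∀ p : ℝ × ℝ, ENNReal.ofReal (Real.exp
      ((c * Complex.measurableEquivRealProd.symm p).re)) =
      ENNReal.ofReal (Real.exp (c.re * p.1)) * ENNReal.ofReal (Real.exp (-c.im * p.2)) := by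
    intro p
    rw [← ENNReal.ofReal_mul (Real.exp_pos _).le, ← Real.exp_add, Complex.mul_re]
    congr 2
    change c.re * p.1 - c.im * p.2 = _
    ring
  simp_rw [h]
  rw [lintegral_prod_mul (f := fun x => ENNReal.ofReal (Real.exp (c.re * x)))
    (g := fun x => ENNReal.ofReal (Real.exp (-c.im * x))) (by fun_prop) (by fun_prop),
    lintegral_exp_gaussianReal_half, lintegral_exp_gaussianReal_half,
    ← ENNReal.ofReal_mul (Real.exp_pos _).le, ← Real.exp_add, Complex.sq_norm,
    Complex.normSq_apply]
  congr 2
  ring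

/-- The positions above the diagonal. -/
abbrev Pairs (n : ℕ) := {p : Fin n × Fin n // p.1 < p.2}

/-- The joint law of the entries of the noise matrix above the diagonal. -/
noncomputable abbrev entriesLaw (n : ℕ) : Measure (Pairs n → ℂ) :=
  Measure.pi fun _ => stdComplexGaussian

variable {n : ℕ}

/-- The Hermitian matrix with zero diagonal and prescribed entries above the diagonal. -/
noncomputable def hermMatrix (u : Pairs n → ℂ) : Matrix (Fin n) (Fin n) ℂ :=
  Matrix.of fun j k =>
    if h : j < k then u ⟨(j, k), h⟩ else if h : k < j then star (u ⟨(k, j), h⟩) else 0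

lemma hermMatrix_of_lt (u : Pairs n → ℂ) {j k : Fin n} (h : j < k) :
    hermMatrix u j k = u ⟨(j, k), h⟩ := by
  simp [hermMatrix, h]

lemma hermMatrix_of_gt (u : Pairs n → ℂ) {j k : Fin n} (h : j < k) :
    hermMatrix u k j = star (u ⟨(j, k), h⟩) := by
  simp [hermMatrix, h, h.not_gt]

lemma hermMatrix_self (u : Pairs n → ℂ) (j : Fin n) : hermMatrix u j j = 0 := by
  simp [hermMatrix]

lemma isHermitian_hermMatrix (u : Pairs n → ℂ) : (hermMatrix u).IsHermitian := by
  ext j k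
  rw [Matrix.conjTranspose_apply]
  rcases lt_trichotomy j k with h | rfl | h
  · rw [hermMatrix_of_lt u h, hermMatrix_of_gt u h, star_star]
  · simp [hermMatrix_self]
  · rw [hermMatrix_of_lt u h, hermMatrix_of_gt u h]

lemma measurable_hermMatrix_apply (j k : Fin n) :
    Measurable fun u : Pairs n → ℂ => hermMatrix u j k := by
  rcases lt_trichotomy j k with h | rfl | h
  · simp only [hermMatrix_of_lt _ h]; fun_prop
  · simp only [hermMatrix_self]; fun_prop
  · simp only [hermMatrix_of_gt _ h]; fun_prop

/-- The entries of `W` above the diagonal. -/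
def upperEntries (W : Matrix (Fin n) (Fin n) ℂ) : Pairs n → ℂ := fun p => W p.1.1 p.1.2

lemma hermMatrix_upperEntries {W : Matrix (Fin n) (Fin n) ℂ} (hW : W.IsHermitian)
    (hdiag : ∀ j, W j j = 0) : hermMatrix (upperEntries W) = W := by
  ext j k
  rcases lt_trichotomy j k with h | rfl | h
  · rw [hermMatrix_of_lt _ h]; rfl
  · rw [hermMatrix_self, hdiag]
  · rw [hermMatrix_of_gt _ h, ← hW.apply j k]; rfl

variable {Ω : Type u} [MeasurableSpace Ω] {P : Measure Ω} {W : Ω → Matrix (Fin n) (Fin n) ℂ}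

lemma IsNoiseMatrix.hasLaw_upperEntries [IsProbabilityMeasure P] (hW : IsNoiseMatrix P W) :
    HasLaw (fun ω => upperEntries (W ω)) (entriesLaw n) P := by
  have hm : ∀ p : Pairs n, AEMeasurable (fun ω => W ω p.1.1 p.1.2) P :=
    fun p => (hW.law _ _ p.2).aemeasurable
  refine ⟨aemeasurable_pi_lambda _ hm, ?_⟩
  have h := (iIndepFun_iff_map_fun_eq_pi_map hm).1 hW.indep
  refine h.trans ?_
  congr 1
  ext1 p
  exact (hW.law _ _ p.2).map_eq

/-- Probabilities of events about the noise matrix can be bounded under `entriesLaw`. -/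
lemma IsNoiseMatrix.measure_le [IsProbabilityMeasure P] (hW : IsNoiseMatrix P W)
    {S : Set (Pairs n → ℂ)} (hS : MeasurableSet S) {T : Set Ω}
    (hT : ∀ ω ∈ T, upperEntries (W ω) ∈ S) : P T ≤ entriesLaw n S := by
  have h := hW.hasLaw_upperEntries
  rw [← h.map_eq, Measure.map_apply_of_aemeasurable h.aemeasurable hS]
  exact measure_mono hT

/-- A sum over off-diagonal positions, grouped by unordered pairs. -/
lemma sum_sum_eq_sum_pairs {M : Type*} [AddCommMonoid M] (f : Fin n → Fin n → M)
    (hf : ∀ j, f j j = 0) :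
    ∑ j, ∑ k, f j k = ∑ p : Pairs n, (f p.1.1 p.1.2 + f p.1.2 p.1.1) := by
  have h1 : ∀ g : Fin n × Fin n → M,
      ∑ p : Pairs n, g p.1 = ∑ p : Fin n × Fin n, if p.1 < p.2 then g p else 0 := by
    intro g
    rw [← Finset.sum_filter]
    exact (Finset.sum_subtype _ (by simp) g).symm
  have h2 : ∑ p : Fin n × Fin n, (if p.1 < p.2 then f p.2 p.1 else 0) =
      ∑ p : Fin n × Fin n, if p.2 < p.1 then f p.1 p.2 else 0 :=
    Fintype.sum_equiv (Equiv.prodComm _ _) _ _ fun p => rfl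
  rw [Finset.sum_add_distrib, h1 fun p => f p.1 p.2, h1 fun p => f p.2 p.1, h2,
    ← Finset.sum_add_distrib, ← Fintype.sum_prod_type']
  refine Finset.sum_congr rfl fun p _ => ?_
  rcases lt_trichotomy p.1 p.2 with h | h | h
  · simp [h, h.not_gt]
  · rw [h]; simp [hf]
  · simp [h, h.not_gt]

lemma lintegral_exp_re_sum (c : Pairs n → ℂ) :
    ∫⁻ u, ENNReal.ofReal (Real.exp ((∑ p, c p * u p).re)) ∂(entriesLaw n) =
      ENNReal.ofReal (Real.exp ((∑ p, ‖c p‖ ^ 2) / 4)) := by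
  have h : ∀ u : Pairs n → ℂ, ENNReal.ofReal (Real.exp ((∑ p, c p * u p).re)) =
      ∏ p, ENNReal.ofReal (Real.exp ((c p * u p).re)) := by
    intro u
    rw [Complex.re_sum, Real.exp_sum, ENNReal.ofReal_prod_of_nonneg fun _ _ => (Real.exp_pos _).le]
  simp_rw [h]
  have hmeas : ∀ p : Pairs n, Measurable fun w : ℂ => ENNReal.ofReal (Real.exp ((c p * w).re)) :=
    fun p => by fun_prop
  have hind := iIndepFun_pi (μ := fun _ : Pairs n => stdComplexGaussian)
    (X := fun p w => ENNReal.ofReal (Real.exp ((c p * w).re))) fun p => (hmeas p).aemeasurable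
  rw [lintegral_prod_eq_prod_lintegral_of_indepFun Finset.univ _ hind
    fun p => (hmeas p).comp (measurable_pi_apply p)]
  have hmarg : ∀ p : Pairs n,
      ∫⁻ u, ENNReal.ofReal (Real.exp ((c p * u p).re)) ∂(entriesLaw n) =
        ENNReal.ofReal (Real.exp (‖c p‖ ^ 2 / 4)) := by
    intro p
    rw [← lintegral_exp_stdComplexGaussian]
    exact (measurePreserving_eval (fun _ : Pairs n => stdComplexGaussian) p).lintegral_comp
      (hmeas p)
  simp_rw [hmarg]
  rw [← ENNReal.ofReal_prod_of_nonneg fun _ _ => (Real.exp_pos _).le, ← Real.exp_sum,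
    Finset.sum_div]

/-- The exponential moments of a linear functional of the noise matrix. -/
lemma lintegral_exp_re_sum_hermMatrix (B : Fin n → Fin n → ℂ) :
    ∫⁻ u, ENNReal.ofReal (Real.exp ((∑ j, ∑ k, B j k * hermMatrix u j k).re)) ∂(entriesLaw n) =
      ENNReal.ofReal (Real.exp
        ((∑ p : Pairs n, ‖B p.1.1 p.1.2 + star (B p.1.2 p.1.1)‖ ^ 2) / 4)) := by
  rw [← lintegral_exp_re_sum]
  refine lintegral_congr fun u => ?_
  congr 2
  rw [sum_sum_eq_sum_pairs _ fun j => by rw [hermMatrix_self, mul_zero], Complex.re_sum,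
    Complex.re_sum]
  refine Finset.sum_congr rfl fun p _ => ?_
  rw [hermMatrix_of_lt u p.2, hermMatrix_of_gt u p.2]
  simp [Complex.add_re, Complex.mul_re]
  ring

end Gaussian

/-! ### Tail of the norm of the noise matrix -/

section NormTail

variable {n : ℕ}

lemma continuous_opNorm : Continuous (opNorm (n := n)) := by
  have h : Continuous (Matrix.toEuclideanCLM (n := Fin n) (𝕜 := ℂ)) :=
    LinearMap.continuous_of_finiteDimensional
      (Matrix.toEuclideanCLM (n := Fin n) (𝕜 := ℂ)).toAlgEquiv.toLinearMap
  exact h.norm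

lemma continuous_hermMatrix : Continuous (hermMatrix (n := n)) := by
  refine continuous_matrix fun j k => ?_
  rcases lt_trichotomy j k with h | rfl | h
  · simp only [hermMatrix_of_lt _ h]; fun_prop
  · simp only [hermMatrix_self]; fun_prop
  · simp only [hermMatrix_of_gt _ h]; fun_prop

lemma measurable_opNorm_hermMatrix : Measurable fun u : Pairs n → ℂ => opNorm (hermMatrix u) :=
  (continuous_opNorm.comp continuous_hermMatrix).measurable

/-- The quadratic form of a matrix. -/
noncomputable def quadForm (A : Matrix (Fin n) (Fin n) ℂ) (x : EuclideanSpace ℂ (Fin n)) : ℝ :=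
  (∑ j, ∑ k, star (x j) * x k * A j k).re

lemma continuous_quadForm_hermMatrix : Continuous
    fun p : (Pairs n → ℂ) × EuclideanSpace ℂ (Fin n) => quadForm (hermMatrix p.1) p.2 := by
  have hH : ∀ j k, Continuous fun p : (Pairs n → ℂ) × EuclideanSpace ℂ (Fin n) =>
      hermMatrix p.1 j k := fun j k => (continuous_hermMatrix.comp continuous_fst).matrix_elem j k
  unfold quadForm
  fun_prop

lemma quadForm_eq_re_inner (A : Matrix (Fin n) (Fin n) ℂ) (x : EuclideanSpace ℂ (Fin n)) :
    quadForm A x = (inner ℂ x (Matrix.toEuclideanCLM (n := Fin n) (𝕜 := ℂ) A x)).re := by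
  rw [quadForm, PiLp.inner_apply]
  congr 1
  refine Finset.sum_congr rfl fun j _ => ?_
  rw [Matrix.ofLp_toEuclideanCLM, Matrix.mulVec, dotProduct, RCLike.inner_apply, Finset.sum_mul]
  refine Finset.sum_congr rfl fun k _ => ?_
  rw [starRingEnd_apply]
  ring

/-- The norm of a Hermitian matrix is nearly attained by its quadratic form, and then on a whole
ball of vectors. -/
lemma exists_ball_half_opNorm_le {A : Matrix (Fin n) (Fin n) ℂ} (hA : A.IsHermitian) :
    ∃ v : EuclideanSpace ℂ (Fin n), ‖v‖ ≤ 1 ∧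
      ∀ x ∈ Metric.ball v (1 / 8), opNorm A / 2 ≤ |quadForm A x| := by
  set T := Matrix.toEuclideanCLM (n := Fin n) (𝕜 := ℂ) A with hT
  have hop : opNorm A = ‖T‖ := rfl
  obtain ⟨v, hv1, hv⟩ : ∃ v : EuclideanSpace ℂ (Fin n), ‖v‖ ≤ 1 ∧
      9 / 10 * ‖T‖ ≤ |(inner ℂ v (T v)).re| := by
    rcases (norm_nonneg T).eq_or_lt with h0 | hpos
    · exact ⟨0, by simp, by simp [← h0]⟩
    have hsymm : (T : EuclideanSpace ℂ (Fin n) →ₗ[ℂ] EuclideanSpace ℂ (Fin n)).IsSymmetric := by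
      rw [hT, Matrix.coe_toEuclideanCLM_eq_toEuclideanLin]
      exact Matrix.isSymmetric_toEuclideanLin_iff.2 hA
    have h1 : 9 / 10 * ‖T‖ < ⨆ x, |T.rayleighQuotient x| := by
      rw [← T.norm_eq_iSup_rayleighQuotient hsymm]; linarith
    obtain ⟨x, hx⟩ := exists_lt_of_lt_ciSup h1
    have hx0 : x ≠ 0 := by
      rintro rfl
      simp [ContinuousLinearMap.rayleighQuotient] at hx
      linarith
    have hxn : ‖x‖ ≠ 0 := norm_ne_zero_iff.2 hx0
    have hc : ((‖x‖⁻¹ : ℝ) : ℂ) ≠ 0 := by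
      rw [Complex.ofReal_ne_zero]; exact inv_ne_zero hxn
    have hn : ‖((‖x‖⁻¹ : ℝ) : ℂ) • x‖ = 1 := by
      rw [norm_smul, Complex.norm_real, norm_inv, norm_norm, inv_mul_cancel₀ hxn]
    refine ⟨((‖x‖⁻¹ : ℝ) : ℂ) • x, hn.le, ?_⟩
    rw [← T.rayleigh_smul x hc, ContinuousLinearMap.rayleighQuotient, hn,
      ContinuousLinearMap.reApplyInnerSelf_apply, one_pow, div_one, ← inner_conj_symm,
      RCLike.conj_re] at hx
    exact hx.le
  refine ⟨v, hv1, fun x hx => ?_⟩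
  rw [hop, quadForm_eq_re_inner]
  have hxv : ‖x - v‖ ≤ 1 / 8 := by
    rw [← dist_eq_norm]; exact (Metric.mem_ball.1 hx).le
  have hx1 : ‖x‖ ≤ 9 / 8 := by
    have := norm_le_norm_add_norm_sub' x v
    linarith
  have hdec : inner ℂ x (T x) =
      inner ℂ v (T v) + (inner ℂ (x - v) (T x) + inner ℂ v (T (x - v))) := by
    rw [map_sub, inner_sub_left, inner_sub_right]
    ring
  have h1 : ‖inner ℂ (x - v) (T x)‖ ≤ 1 / 8 * (‖T‖ * (9 / 8)) :=
    (norm_inner_le_norm _ _).trans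
      (mul_le_mul hxv ((T.le_opNorm x).trans (by gcongr)) (norm_nonneg _) (by norm_num))
  have h2 : ‖inner ℂ v (T (x - v))‖ ≤ 1 * (‖T‖ * (1 / 8)) :=
    (norm_inner_le_norm _ _).trans
      (mul_le_mul hv1 ((T.le_opNorm _).trans (by gcongr)) (norm_nonneg _) (by norm_num))
  have h3 := Complex.abs_re_le_norm (inner ℂ (x - v) (T x) + inner ℂ v (T (x - v)))
  have h4 := norm_add_le (inner ℂ (x - v) (T x)) (inner ℂ v (T (x - v)))
  have h5 := abs_sub_abs_le_abs_sub (inner ℂ v (T v)).re (inner ℂ x (T x)).re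
  rw [hdec, Complex.add_re, sub_add_cancel_left, abs_neg, ← Complex.add_re, ← hdec] at h5
  linarith [norm_nonneg T]

lemma sum_pairs_le {f : Fin n → Fin n → ℝ} (hf : ∀ j k, 0 ≤ f j k) :
    ∑ p : Pairs n, f p.1.1 p.1.2 ≤ ∑ j, ∑ k, f j k := by
  rw [← Fintype.sum_prod_type' f,
    ← Finset.sum_subtype (Finset.univ.filter fun p : Fin n × Fin n => p.1 < p.2) (by simp)
      fun p => f p.1 p.2]
  exact Finset.sum_le_sum_of_subset_of_nonneg (Finset.subset_univ _) fun _ _ _ => hf _ _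

lemma lintegral_exp_quadForm_le (t : ℝ) {x : EuclideanSpace ℂ (Fin n)} (hx : ‖x‖ ≤ 2) :
    ∫⁻ u, ENNReal.ofReal (Real.exp (t * quadForm (hermMatrix u) x)) ∂(entriesLaw n) ≤
      ENNReal.ofReal (Real.exp (16 * t ^ 2)) := by
  have h := lintegral_exp_re_sum_hermMatrix fun j k : Fin n => (t : ℂ) * (star (x j) * x k)
  have h1 : ∀ u : Pairs n → ℂ, t * quadForm (hermMatrix u) x =
      (∑ j, ∑ k, (t : ℂ) * (star (x j) * x k) * hermMatrix u j k).re := by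
    intro u
    rw [quadForm, ← Complex.re_ofReal_mul, Finset.mul_sum]
    simp only [Finset.mul_sum, mul_assoc]
  simp_rw [h1]
  rw [h]
  refine ENNReal.ofReal_le_ofReal (Real.exp_le_exp.2 ?_)
  have h2 : ∀ p : Pairs n, ‖(t : ℂ) * (star (x p.1.1) * x p.1.2) +
      star ((t : ℂ) * (star (x p.1.2) * x p.1.1))‖ ^ 2 =
      4 * t ^ 2 * (‖x p.1.1‖ ^ 2 * ‖x p.1.2‖ ^ 2) := by
    intro p
    have : (t : ℂ) * (star (x p.1.1) * x p.1.2) + star ((t : ℂ) * (star (x p.1.2) * x p.1.1)) =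
        2 * ((t : ℂ) * (star (x p.1.1) * x p.1.2)) := by
      have ht : star (t : ℂ) = t := Complex.conj_ofReal t
      rw [star_mul, star_mul, star_star, ht]
      ring
    rw [this, norm_mul, norm_mul, norm_mul, norm_star, Complex.norm_real, Real.norm_eq_abs,
      mul_pow, mul_pow, mul_pow, sq_abs]
    norm_num
    ring
  simp_rw [h2]
  have h3 := sum_pairs_le (f := fun j k : Fin n => 4 * t ^ 2 * (‖x j‖ ^ 2 * ‖x k‖ ^ 2))
    fun _ _ => by positivity
  have h4 : ∑ j, ∑ k, 4 * t ^ 2 * (‖x j‖ ^ 2 * ‖x k‖ ^ 2) = 4 * t ^ 2 * (‖x‖ ^ 2 * ‖x‖ ^ 2) := by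
    rw [EuclideanSpace.norm_sq_eq, Finset.sum_mul_sum]
    simp only [Finset.mul_sum]
  have h5 : ‖x‖ ^ 2 ≤ 4 := by
    have := pow_le_pow_left₀ (norm_nonneg _) hx 2
    linarith
  have h6 : 4 * t ^ 2 * (‖x‖ ^ 2 * ‖x‖ ^ 2) ≤ 4 * t ^ 2 * (4 * 4) := by gcongr
  linarith

/-- A two-sided exponential of the quadratic form of the noise matrix. -/
noncomputable def expForm (t : ℝ) (u : Pairs n → ℂ) (x : EuclideanSpace ℂ (Fin n)) : ENNReal :=
  ENNReal.ofReal (Real.exp (t * quadForm (hermMatrix u) x)) +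
    ENNReal.ofReal (Real.exp (-t * quadForm (hermMatrix u) x))

lemma measurable_uncurry_expForm (t : ℝ) : Measurable (Function.uncurry (expForm (n := n) t)) := by
  have hq := continuous_quadForm_hermMatrix (n := n)
  have h1 : ∀ r : ℝ, Measurable fun p : (Pairs n → ℂ) × EuclideanSpace ℂ (Fin n) =>
      ENNReal.ofReal (Real.exp (r * quadForm (hermMatrix p.1) p.2)) := fun r =>
    ENNReal.measurable_ofReal.comp (Real.measurable_exp.comp (hq.measurable.const_mul r))
  unfold Function.uncurry expForm
  exact (h1 t).add (h1 (-t))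

lemma ofReal_exp_le_expForm {t a : ℝ} {u : Pairs n → ℂ} {x : EuclideanSpace ℂ (Fin n)}
    (h : a ≤ t * |quadForm (hermMatrix u) x|) : ENNReal.ofReal (Real.exp a) ≤ expForm t u x := by
  rcases abs_cases (quadForm (hermMatrix u) x) with ⟨h3, -⟩ | ⟨h3, -⟩
  · rw [h3] at h
    exact le_add_of_le_left (ENNReal.ofReal_le_ofReal (Real.exp_le_exp.2 h))
  · rw [h3] at h
    exact le_add_of_le_right (ENNReal.ofReal_le_ofReal (Real.exp_le_exp.2 (by linarith)))

lemma lintegral_expForm_le (t : ℝ) {x : EuclideanSpace ℂ (Fin n)} (hx : ‖x‖ ≤ 2) :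
    ∫⁻ u, expForm t u x ∂(entriesLaw n) ≤ ENNReal.ofReal (2 * Real.exp (16 * t ^ 2)) := by
  have hq : Continuous fun u : Pairs n → ℂ => quadForm (hermMatrix u) x := by
    have hH : ∀ j k, Continuous fun u : Pairs n → ℂ => hermMatrix u j k :=
      fun j k => continuous_hermMatrix.matrix_elem j k
    unfold quadForm
    fun_prop
  have hm : Measurable fun u : Pairs n → ℂ =>
      ENNReal.ofReal (Real.exp (t * quadForm (hermMatrix u) x)) :=
    ENNReal.measurable_ofReal.comp (Real.measurable_exp.comp (hq.measurable.const_mul t))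
  have h2 := lintegral_exp_quadForm_le (-t) hx
  rw [neg_sq] at h2
  simp only [expForm]
  rw [lintegral_add_left hm]
  refine (add_le_add (lintegral_exp_quadForm_le t hx) h2).trans (le_of_eq ?_)
  rw [← ENNReal.ofReal_add (Real.exp_pos _).le (Real.exp_pos _).le, two_mul]

lemma two_mul_exp_mul_two_pow_le (hn : 1 ≤ n) :
    2 * Real.exp (16 * n) * 2 ^ (2 * n) ≤
      Real.exp (50 * n) * (1 / 8) ^ (2 * n) * Real.exp (-(20 * n)) := by
  have hn' : (1 : ℝ) ≤ n := by exact_mod_cast hn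
  have he := Real.exp_one_gt_d9
  have h256 : (256 : ℝ) ≤ Real.exp 6 := by
    have : Real.exp 6 = Real.exp 1 ^ 6 := by rw [← Real.exp_nat_mul]; norm_num
    rw [this]
    calc (256 : ℝ) ≤ 2.7 ^ 6 := by norm_num
      _ ≤ _ := by gcongr; linarith
  have h2 : (2 : ℝ) ≤ Real.exp n := by
    calc (2 : ℝ) ≤ Real.exp 1 := by linarith
      _ ≤ _ := Real.exp_le_exp.2 hn'
  have h3 : (256 : ℝ) ^ n ≤ Real.exp (6 * n) := by
    rw [mul_comm, Real.exp_nat_mul]; gcongr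
  have h4 : (2 : ℝ) ^ (2 * n) = 256 ^ n * (1 / 8) ^ (2 * n) := by
    rw [pow_mul, pow_mul, ← mul_pow]; norm_num
  rw [h4]
  calc 2 * Real.exp (16 * n) * (256 ^ n * (1 / 8) ^ (2 * n))
      ≤ Real.exp n * Real.exp (16 * n) * (Real.exp (6 * n) * (1 / 8) ^ (2 * n)) := by gcongr
    _ = Real.exp (n + 16 * n + 6 * n) * (1 / 8) ^ (2 * n) := by
        rw [Real.exp_add, Real.exp_add]; ring
    _ ≤ Real.exp (50 * n + -(20 * n)) * (1 / 8) ^ (2 * n) := by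
        refine mul_le_mul_of_nonneg_right (Real.exp_le_exp.2 ?_) (by positivity)
        linarith
    _ = _ := by rw [Real.exp_add]; ring

/-- Exponential tail of the norm of the noise matrix. The exponential moment of the norm is
bounded by averaging the exponential of the quadratic form over a ball of vectors: around the
extremal vector the average sees a small ball, whose relative volume is only exponentially small in
the dimension. This replaces a union bound over a net. -/
lemma entriesLaw_opNorm_gt_le (hn : 1 ≤ n) :
    entriesLaw n {u | 100 * √(n : ℝ) < opNorm (hermMatrix u)} ≤
      ENNReal.ofReal (Real.exp (-(20 * n))) := by
  set μ : Measure (EuclideanSpace ℂ (Fin n)) := Measure.addHaar with hμ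
  set t := √(n : ℝ) with ht
  have ht2 : t * t = n := Real.mul_self_sqrt (Nat.cast_nonneg n)
  have ht0 : 0 ≤ t := Real.sqrt_nonneg _
  have hFmeas : Measurable fun u : Pairs n → ℂ =>
      ∫⁻ x in Metric.ball (0 : EuclideanSpace ℂ (Fin n)) 2, expForm t u x ∂μ :=
    Measurable.lintegral_prod_right' (measurable_uncurry_expForm t)
  have hball : ∀ (x : EuclideanSpace ℂ (Fin n)) {r : ℝ}, 0 < r → μ (Metric.ball x r) =
      ENNReal.ofReal (r ^ (2 * n)) * μ (Metric.ball 0 1) := by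
    intro x r hr
    rw [μ.addHaar_ball_of_pos x hr, finrank_real_of_complex, finrank_euclideanSpace,
      Fintype.card_fin]
  have hb0 : μ (Metric.ball 0 1) ≠ 0 := (Metric.measure_ball_pos _ _ one_pos).ne'
  have hbtop : μ (Metric.ball 0 1) ≠ ⊤ := measure_ball_lt_top.ne
  generalize μ (Metric.ball 0 1) = b at hball hb0 hbtop
  set ε : ENNReal := ENNReal.ofReal (Real.exp (50 * n)) * (ENNReal.ofReal ((1 / 8) ^ (2 * n)) * b)
    with hε
  -- on the event, the average over the ball is large
  have hlow : {u | 100 * t < opNorm (hermMatrix u)} ⊆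
      {u | ε ≤ ∫⁻ x in Metric.ball (0 : EuclideanSpace ℂ (Fin n)) 2, expForm t u x ∂μ} := by
    intro u hu
    have hu' : 100 * t < opNorm (hermMatrix u) := hu
    obtain ⟨v, hv1, hv⟩ := exists_ball_half_opNorm_le (isHermitian_hermMatrix u)
    have hsub : Metric.ball v (1 / 8) ⊆ Metric.ball (0 : EuclideanSpace ℂ (Fin n)) 2 := by
      refine Metric.ball_subset_ball' ?_
      rw [dist_zero_right]
      linarith
    have hge : ∀ x ∈ Metric.ball v (1 / 8),
        ENNReal.ofReal (Real.exp (50 * n)) ≤ expForm t u x := by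
      intro x hx
      refine ofReal_exp_le_expForm ?_
      rw [← ht2]
      nlinarith [hv x hx]
    have hint := setLIntegral_mono' (μ := μ) measurableSet_ball hge
    rw [setLIntegral_const, hball v (by norm_num)] at hint
    exact hint.trans (lintegral_mono_set hsub)
  have hup : ∫⁻ u, ∫⁻ x in Metric.ball (0 : EuclideanSpace ℂ (Fin n)) 2, expForm t u x ∂μ
      ∂(entriesLaw n) ≤
      ENNReal.ofReal (2 * Real.exp (16 * n)) * (ENNReal.ofReal (2 ^ (2 * n)) * b) := by
    rw [lintegral_lintegral_swap (measurable_uncurry_expForm t).aemeasurable, ← hball 0 two_pos,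
      ← setLIntegral_const]
    refine setLIntegral_mono' measurableSet_ball fun x hx => ?_
    rw [← ht2, ← sq]
    exact lintegral_expForm_le t (mem_ball_zero_iff.1 hx).le
  have hmark := (mul_meas_ge_le_lintegral₀ (μ := entriesLaw n) hFmeas.aemeasurable ε).trans hup
  have hε0 : ε ≠ 0 := by
    refine mul_ne_zero ?_ (mul_ne_zero ?_ hb0) <;>
      simp only [ne_eq, ENNReal.ofReal_eq_zero, not_le] <;> positivity
  have hεtop : ε ≠ ⊤ :=
    ENNReal.mul_ne_top ENNReal.ofReal_ne_top (ENNReal.mul_ne_top ENNReal.ofReal_ne_top hbtop)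
  refine (measure_mono hlow).trans ((ENNReal.mul_le_mul_iff_right hε0 hεtop).1 (hmark.trans ?_))
  rw [hε, ← mul_assoc, ← mul_assoc, ← ENNReal.ofReal_mul (by positivity),
    ← ENNReal.ofReal_mul (by positivity), mul_right_comm _ b, ← ENNReal.ofReal_mul (by positivity)]
  exact mul_le_mul_left (ENNReal.ofReal_le_ofReal (two_mul_exp_mul_two_pow_le hn)) b

end NormTail

/-! ### Large noise at a single column -/

section RowTail

variable {n : ℕ}

lemma hermMatrix_apply_congr {u u' : Pairs n → ℂ} {j : Fin n}
    (h : ∀ p : Pairs n, p.1.1 = j ∨ p.1.2 = j → u p = u' p) (k : Fin n) :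
    hermMatrix u k j = hermMatrix u' k j := by
  rcases lt_trichotomy k j with hk | rfl | hk
  · rw [hermMatrix_of_lt _ hk, hermMatrix_of_lt _ hk, h _ (Or.inr rfl)]
  · rw [hermMatrix_self, hermMatrix_self]
  · rw [hermMatrix_of_gt _ hk, hermMatrix_of_gt _ hk, h _ (Or.inl rfl)]

/-- Coefficients that ignore the entries with an index `j` are independent of column `j` of the
noise matrix. -/
lemma indepFun_column {j : Fin n} {y : (Pairs n → ℂ) → Fin n → ℂ} (hy : Measurable y)
    (hdep : ∀ u u' : Pairs n → ℂ, (∀ p : Pairs n, p.1.1 ≠ j → p.1.2 ≠ j → u p = u' p) →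
      y u = y u') :
    IndepFun (fun u : Pairs n → ℂ => fun k => hermMatrix u k j) y (entriesLaw n) := by
  classical
  let S : Finset (Pairs n) := Finset.univ.filter fun p => p.1.1 = j ∨ p.1.2 = j
  let T : Finset (Pairs n) := Finset.univ.filter fun p => ¬ (p.1.1 = j ∨ p.1.2 = j)
  have hST : Disjoint S T := Finset.disjoint_filter_filter_not _ _ _
  have hind : iIndepFun (fun (p : Pairs n) (u : Pairs n → ℂ) => u p) (entriesLaw n) :=
    iIndepFun_pi (μ := fun _ : Pairs n => stdComplexGaussian) (X := fun _ w => w)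
      fun _ => aemeasurable_id
  have h := hind.indepFun_finset S T hST fun p => measurable_pi_apply p
  let ext : (R : Finset (Pairs n)) → (R → ℂ) → Pairs n → ℂ :=
    fun R a p => if hp : p ∈ R then a ⟨p, hp⟩ else 0
  have hext : ∀ R, Measurable (ext R) := by
    intro R
    refine measurable_pi_lambda _ fun p => ?_
    by_cases hp : p ∈ R
    · simp only [ext, hp, dif_pos]
      fun_prop
    · simp only [ext, hp, dif_neg, not_false_eq_true]
      fun_prop
  have hrow : Measurable fun (a : S → ℂ) k => hermMatrix (ext S a) k j :=
    measurable_pi_lambda _ fun k => (measurable_hermMatrix_apply k j).comp (hext S)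
  have h2 := h.comp hrow (hy.comp (hext T))
  convert h2 using 1
  · ext u k
    refine hermMatrix_apply_congr (fun p hp => ?_) k
    have hpS : p ∈ S := by simpa [S] using hp
    simp [ext, hpS]
  · ext1 u
    refine hdep _ _ fun p h1 h2 => ?_
    have hpT : p ∈ T := by simp [T, h1, h2]
    simp [ext, hpT]

lemma lintegral_exp_column_const_le (j : Fin n) (c : ℂ) {z : Fin n → ℂ} (hz : ∀ k, ‖z k‖ ≤ 1) :
    ∫⁻ u, ENNReal.ofReal (Real.exp ((c * ∑ k, z k * hermMatrix u k j).re)) ∂(entriesLaw n) ≤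
      ENNReal.ofReal (Real.exp (‖c‖ ^ 2 * n / 4)) := by
  have h := lintegral_exp_re_sum_hermMatrix fun k l : Fin n => if l = j then c * z k else 0
  have h1 : ∀ u : Pairs n → ℂ, c * ∑ k, z k * hermMatrix u k j =
      ∑ k, ∑ l, (if l = j then c * z k else 0) * hermMatrix u k l := by
    intro u
    simp [ite_mul, Finset.mul_sum, mul_assoc]
  simp_rw [h1]
  rw [h]
  refine ENNReal.ofReal_le_ofReal (Real.exp_le_exp.2 ?_)
  gcongr
  have hcz : ∀ k, ‖c * z k‖ ^ 2 ≤ ‖c‖ ^ 2 := by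
    intro k
    rw [norm_mul, mul_pow]
    exact mul_le_of_le_one_right (by positivity) (pow_le_one₀ (norm_nonneg _) (hz k))
  calc ∑ p : Pairs n, ‖(if p.1.2 = j then c * z p.1.1 else 0) +
        star (if p.1.1 = j then c * z p.1.2 else 0)‖ ^ 2
      ≤ ∑ p : Pairs n, ((if p.1.2 = j ∧ p.1.1 ≠ j then ‖c‖ ^ 2 else 0) +
          (if p.1.1 = j ∧ p.1.2 ≠ j then ‖c‖ ^ 2 else 0)) := by
        refine Finset.sum_le_sum fun p _ => ?_
        by_cases h1 : p.1.1 = j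
        · have h2 : p.1.2 ≠ j := fun h2 => p.2.ne (h1.trans h2.symm)
          simp only [h1, h2, if_true, if_false, zero_add, norm_star, ne_eq, not_true_eq_false,
            not_false_eq_true, and_self]
          exact hcz _
        · by_cases h2 : p.1.2 = j
          · simp only [h1, h2, if_true, if_false, star_zero, add_zero, ne_eq, not_false_eq_true,
              and_self, not_true_eq_false]
            exact hcz _
          · simp [h1, h2]
    _ = ∑ k, ∑ l, if l = j ∧ k ≠ j then ‖c‖ ^ 2 else 0 :=
        (sum_sum_eq_sum_pairs (fun k l => if l = j ∧ k ≠ j then ‖c‖ ^ 2 else 0)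
          fun k => by simp).symm
    _ ≤ ∑ _k : Fin n, ‖c‖ ^ 2 := by
        refine Finset.sum_le_sum fun k _ => ?_
        by_cases hk : k = j
        · simp [hk]
        · simp [hk]
    _ = ‖c‖ ^ 2 * n := by simp [mul_comm]

/-- Since the coefficients are independent of the column, they can be frozen when integrating over
the column. -/
lemma lintegral_exp_column_le {j : Fin n} {y : (Pairs n → ℂ) → Fin n → ℂ} (hy : Measurable y)
    (hy1 : ∀ u k, ‖y u k‖ ≤ 1)
    (hdep : ∀ u u' : Pairs n → ℂ, (∀ p : Pairs n, p.1.1 ≠ j → p.1.2 ≠ j → u p = u' p) →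
      y u = y u') (c : ℂ) :
    ∫⁻ u, ENNReal.ofReal (Real.exp ((c * ∑ k, y u k * hermMatrix u k j).re)) ∂(entriesLaw n) ≤
      ENNReal.ofReal (Real.exp (‖c‖ ^ 2 * n / 4)) := by
  let R : (Pairs n → ℂ) → Fin n → ℂ := fun u k => hermMatrix u k j
  have hR : Measurable R := measurable_pi_lambda _ fun k => measurable_hermMatrix_apply k j
  let h : (Fin n → ℂ) × (Fin n → ℂ) → ENNReal :=
    fun q => ENNReal.ofReal (Real.exp ((c * ∑ k, q.2 k * q.1 k).re))
  have hh : Measurable h := by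
    simp only [h]
    fun_prop
  have hmap := (indepFun_iff_map_prod_eq_prod_map_map hR.aemeasurable hy.aemeasurable).1
    (indepFun_column hy hdep)
  have : IsProbabilityMeasure (Measure.map R (entriesLaw n)) :=
    Measure.isProbabilityMeasure_map hR.aemeasurable
  have : IsProbabilityMeasure (Measure.map y (entriesLaw n)) :=
    Measure.isProbabilityMeasure_map hy.aemeasurable
  calc ∫⁻ u, ENNReal.ofReal (Real.exp ((c * ∑ k, y u k * hermMatrix u k j).re)) ∂(entriesLaw n)
      = ∫⁻ q, h q ∂(Measure.map (fun u => (R u, y u)) (entriesLaw n)) :=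
        (lintegral_map hh (hR.prodMk hy)).symm
    _ = ∫⁻ z, ∫⁻ r, h (r, z) ∂(Measure.map R (entriesLaw n)) ∂(Measure.map y (entriesLaw n)) := by
        rw [hmap, lintegral_prod_symm' _ hh]
    _ = ∫⁻ u', ∫⁻ r, h (r, y u') ∂(Measure.map R (entriesLaw n)) ∂(entriesLaw n) :=
        lintegral_map hh.lintegral_prod_left' hy
    _ ≤ ∫⁻ _u', ENNReal.ofReal (Real.exp (‖c‖ ^ 2 * n / 4)) ∂(entriesLaw n) := by
        refine lintegral_mono fun u' => ?_
        rw [lintegral_map (f := fun r => h (r, y u')) (hh.comp measurable_prodMk_right) hR]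
        exact lintegral_exp_column_const_le j c (hy1 u')
    _ = _ := by rw [lintegral_const, measure_univ, mul_one]

/-- Gaussian tail of a linear combination of column `j`, with bounded coefficients that are
independent of that column. -/
lemma entriesLaw_lt_norm_sum_column_le (hn : 1 ≤ n) {j : Fin n} {y : (Pairs n → ℂ) → Fin n → ℂ}
    (hy : Measurable y) (hy1 : ∀ u k, ‖y u k‖ ≤ 1)
    (hdep : ∀ u u' : Pairs n → ℂ, (∀ p : Pairs n, p.1.1 ≠ j → p.1.2 ≠ j → u p = u' p) →
      y u = y u') {a : ℝ} (ha : 0 ≤ a) :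
    entriesLaw n {u | 2 * a ^ 2 < ‖∑ k, y u k * hermMatrix u k j‖ ^ 2} ≤
      ENNReal.ofReal (4 * Real.exp (-(a ^ 2 / n))) := by
  have hn' : (0 : ℝ) < n := by exact_mod_cast hn
  -- the optimal parameter in the Chernoff bound
  set t : ℝ := 2 * a / n with ht
  have ht0 : 0 ≤ t := by positivity
  set g : (Pairs n → ℂ) → ℂ := fun u => ∑ k, y u k * hermMatrix u k j with hg
  have hgm : Measurable g := Finset.measurable_sum _ fun k _ =>
    ((measurable_pi_apply k).comp hy).mul (measurable_hermMatrix_apply k j)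
  let f : ℂ → (Pairs n → ℂ) → ENNReal := fun c u => ENNReal.ofReal (Real.exp ((c * g u).re))
  have hfm : ∀ c, Measurable (f c) := fun c => by fun_prop
  -- four directions suffice: a complex number of modulus `√2 a` has real or imaginary part of
  -- absolute value at least `a`
  let c : Fin 4 → ℂ := ![t, -t, t * Complex.I, -(t * Complex.I)]
  have hc : ∀ i, ‖c i‖ = t := by
    intro i
    fin_cases i <;> simp [c, abs_of_nonneg ht0]
  have hF : ∫⁻ u, ∑ i, f (c i) u ∂(entriesLaw n) ≤ 4 * ENNReal.ofReal (Real.exp (a ^ 2 / n)) := by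
    rw [lintegral_finsetSum _ fun i _ => hfm (c i)]
    have : ∀ i ∈ (Finset.univ : Finset (Fin 4)), ∫⁻ u, f (c i) u ∂(entriesLaw n) ≤
        ENNReal.ofReal (Real.exp (a ^ 2 / n)) := by
      intro i _
      refine (lintegral_exp_column_le hy hy1 hdep (c i)).trans (le_of_eq ?_)
      rw [hc i]
      congr 2
      rw [ht]
      field_simp
      ring
    refine (Finset.sum_le_card_nsmul _ _ _ this).trans (le_of_eq ?_)
    simp [nsmul_eq_mul]
  set ε := ENNReal.ofReal (Real.exp (t * a)) with hε
  have hsub : {u | 2 * a ^ 2 < ‖g u‖ ^ 2} ⊆ {u | ε ≤ ∑ i, f (c i) u} := by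
    intro u hu
    have hu' : 2 * a ^ 2 < ‖g u‖ ^ 2 := hu
    rw [Complex.sq_norm, Complex.normSq_apply] at hu'
    have key : ∃ i, t * a ≤ (c i * g u).re := by
      by_contra! hcon
      have h0 := hcon 0
      have h1 := hcon 1
      have h2 := hcon 2
      have h3 := hcon 3
      simp [c] at h0 h1 h2 h3
      rcases ht0.eq_or_lt with h | h
      · rw [← h] at h0; simp at h0
      · have hre : |(g u).re| < a := by
          rw [abs_lt]; constructor <;> nlinarith
        have him : |(g u).im| < a := by
          rw [abs_lt]; constructor <;> nlinarith
        have := sq_lt_sq' (by linarith [abs_nonneg (g u).re]) hre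
        have := sq_lt_sq' (by linarith [abs_nonneg (g u).im]) him
        simp only [sq_abs] at *
        nlinarith
    obtain ⟨i, hi⟩ := key
    exact (ENNReal.ofReal_le_ofReal (Real.exp_le_exp.2 hi)).trans
      (Finset.single_le_sum (f := fun i => f (c i) u) (fun _ _ => zero_le) (Finset.mem_univ i))
  have hmark := (mul_meas_ge_le_lintegral₀ (μ := entriesLaw n)
    (Finset.measurable_sum Finset.univ fun i _ => hfm (c i)).aemeasurable ε).trans hF
  have hε0 : ε ≠ 0 := by
    simp only [hε, ne_eq, ENNReal.ofReal_eq_zero, not_le]; positivity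
  refine (measure_mono hsub).trans
    ((ENNReal.mul_le_mul_iff_right hε0 ENNReal.ofReal_ne_top).1 ?_)
  refine hmark.trans (le_of_eq ?_)
  rw [hε, ← ENNReal.ofReal_mul (Real.exp_pos _).le, ← ENNReal.ofReal_ofNat 4,
    ← ENNReal.ofReal_mul (by norm_num), mul_left_comm, ← Real.exp_add]
  congr 3
  rw [ht]
  ring

lemma measurable_indicator_fixedPoint {K s : ℝ} (hK : 0 ≤ K) (hs : 0 ≤ s)
    (hsK : s * K ≤ 1 / 1000) :
    Measurable ({A : Fin n → Fin n → ℂ | ActBound A K}.indicator fun A => fixedPoint s A) := by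
  classical
  rw [← Set.piecewise_eq_indicator]
  exact (continuousOn_fixedPoint hK hs hsK).measurable_piecewise continuousOn_const
    (isClosed_actBound K).measurableSet

/-- A large noise term at column `j` is, on the event that the noise has small norm, contained in
an event of Gaussian probability. -/
lemma exists_measurableSet_large_noise (hn : 1 ≤ n) {z : Fin n → ℂ} (hz : z ∈ phases n)
    {K s : ℝ} (hK : 0 ≤ K) (hs : 0 < s) (hsK : s * K ≤ 1 / 1000) (j : Fin n) :
    ∃ S : Set (Pairs n → ℂ), MeasurableSet S ∧
      entriesLaw n S ≤ ENNReal.ofReal (4 * Real.exp (-(9 / (32 * s ^ 2 * n)))) ∧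
      ∀ u, opNorm (hermMatrix u) ≤ K → 13 / 16 < s *
        ‖act (gauge z (hermMatrix u)) (fixedPoint s (gauge z (hermMatrix u))) j‖ → u ∈ S := by
  let A : (Pairs n → ℂ) → Fin n → Fin n → ℂ := fun u => gauge z (eraseIndex j (hermMatrix u))
  let x : (Pairs n → ℂ) → PiLp 2 (fun _ : Fin n => ℂ) := fun u =>
    {A : Fin n → Fin n → ℂ | ActBound A K}.indicator (fun A => fixedPoint s A) (A u)
  have hA : Measurable A := by
    refine measurable_pi_lambda _ fun k => measurable_pi_lambda _ fun l => ?_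
    simp only [A, gauge, eraseIndex]
    split_ifs
    · fun_prop
    · exact ((measurable_hermMatrix_apply k l).const_mul _).mul_const _
  have hx : Measurable x := (measurable_indicator_fixedPoint hK hs.le hsK).comp hA
  let y : (Pairs n → ℂ) → Fin n → ℂ := fun u k => x u k * star (z k)
  have hy : Measurable y := by
    refine measurable_pi_lambda _ fun k => ?_
    have : Measurable fun u => x u k :=
      ((by fun_prop : Continuous fun v : PiLp 2 (fun _ : Fin n => ℂ) => v k).measurable).comp hx
    exact this.mul_const _
  have hy1 : ∀ u k, ‖y u k‖ ≤ 1 := by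
    intro u k
    simp only [y, norm_mul, norm_star, hz k, mul_one, x, Set.indicator]
    split_ifs
    · exact norm_fixedPoint_apply_le _ _ _
    · simp
  have hdep : ∀ u u' : Pairs n → ℂ, (∀ p : Pairs n, p.1.1 ≠ j → p.1.2 ≠ j → u p = u' p) →
      y u = y u' := by
    intro u u' h
    have : A u = A u' := by
      ext k l
      simp only [A, gauge, eraseIndex]
      split_ifs with hkl
      · rfl
      · push Not at hkl
        congr 2
        rcases lt_trichotomy k l with h1 | rfl | h1
        · rw [hermMatrix_of_lt _ h1, hermMatrix_of_lt _ h1, h _ hkl.1 hkl.2]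
        · rw [hermMatrix_self, hermMatrix_self]
        · rw [hermMatrix_of_gt _ h1, hermMatrix_of_gt _ h1, h _ hkl.2 hkl.1]
    simp only [y, x, this]
  set a : ℝ := 3 / (4 * √2 * s) with ha
  have ha2 : 2 * a ^ 2 = (3 / (4 * s)) ^ 2 := by
    rw [ha, div_pow, div_pow, mul_pow, mul_pow, Real.sq_sqrt (by norm_num)]
    field_simp
  refine ⟨{u | 2 * a ^ 2 < ‖∑ k, y u k * hermMatrix u k j‖ ^ 2}, ?_, ?_, ?_⟩
  · refine measurableSet_lt measurable_const (Measurable.pow_const (Measurable.norm ?_) 2)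
    exact Finset.measurable_sum _ fun k _ =>
      ((measurable_pi_apply k).comp hy).mul (measurable_hermMatrix_apply k j)
  · refine (entriesLaw_lt_norm_sum_column_le hn hy hy1 hdep (by positivity)).trans (le_of_eq ?_)
    congr 4
    have : a ^ 2 = (3 / (4 * s)) ^ 2 / 2 := by linarith
    rw [this]
    field_simp
    norm_num
  · intro u hu hj
    have h := lt_mul_norm_sum_looWeights hz (isHermitian_hermMatrix u) hu hs.le hsK hj
    have hbound : ActBound (A u) K := by
      have hg : A u = eraseIndex j (gauge z (hermMatrix u)) := by
        ext k l
        simp only [A, gauge, eraseIndex]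
        split_ifs <;> simp
      rw [hg]
      exact (actBound_gauge hz (isHermitian_hermMatrix u) hu).eraseIndex hK j
    have hyl : ∀ k, y u k = looWeights s z j (hermMatrix u) k := by
      intro k
      simp only [y, x, looWeights]
      rw [Set.indicator_of_mem (by exact hbound)]
    simp only [Set.mem_ofPred_eq, hyl, ha2]
    refine pow_lt_pow_left₀ ?_ (by positivity) two_ne_zero
    rw [div_lt_iff₀ (by positivity)]
    linarith

end RowTail

/-! ### Measurability of the loss and the final estimates -/

section Final

variable {n m : ℕ} {Ω : Type u} [MeasurableSpace Ω] {P : Measure Ω}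

lemma exp_neg_twenty_mul_le (hn : 1 ≤ n) :
    Real.exp (-(20 * n)) ≤ (n : ℝ) ^ (-10 : ℤ) / 4 := by
  have hn' : (1 : ℝ) ≤ n := by exact_mod_cast hn
  have h1 : (n : ℝ) ≤ Real.exp n := by linarith [Real.add_one_le_exp (n : ℝ)]
  have h2 : (n : ℝ) ^ 10 ≤ Real.exp (10 * n) := by
    have : Real.exp (10 * n) = Real.exp n ^ 10 := by rw [← Real.exp_nat_mul]; norm_num
    rw [this]; gcongr
  have h3 : (4 : ℝ) ≤ Real.exp (10 * n) := by linarith [Real.add_one_le_exp (10 * n : ℝ)]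
  have h4 : (4 : ℝ) * n ^ 10 ≤ Real.exp (20 * n) := by
    calc (4 : ℝ) * n ^ 10 ≤ Real.exp (10 * n) * Real.exp (10 * n) := by gcongr
      _ = _ := by rw [← Real.exp_add]; ring_nf
  rw [Real.exp_neg, show (-10 : ℤ) = -((10 : ℕ) : ℤ) by norm_num, _root_.zpow_neg,
    zpow_natCast, div_eq_mul_inv, ← mul_inv]
  gcongr
  linarith

lemma entriesLaw_opNorm_gt_le_zpow (hn : 1 ≤ n) :
    entriesLaw n {u | 100 * √(n : ℝ) < opNorm (hermMatrix u)} ≤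
      ENNReal.ofReal ((n : ℝ) ^ (-10 : ℤ) / 4) :=
  (entriesLaw_opNorm_gt_le hn).trans (ENNReal.ofReal_le_ofReal (exp_neg_twenty_mul_le hn))

lemma measurableSet_opNorm_hermMatrix_gt (c : ℝ) :
    MeasurableSet {u : Pairs n → ℂ | c < opNorm (hermMatrix u)} :=
  measurableSet_lt measurable_const measurable_opNorm_hermMatrix

lemma one_sub_le_measureReal [IsProbabilityMeasure P] {S T : Set Ω} {c : ℝ} (hc : 0 ≤ c)
    (hST : ∀ᵐ ω ∂P, ω ∉ S → ω ∈ T) (hS : P S ≤ ENNReal.ofReal c) : 1 - c ≤ P.real T := by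
  have h1 : P Set.univ ≤ P (S ∪ T) := by
    refine measure_mono_ae ?_
    filter_upwards [hST] with ω hω _
    by_cases h : ω ∈ S
    · exact Or.inl h
    · exact Or.inr (hω h)
  have h2 := h1.trans (measure_union_le S T)
  rw [measure_univ] at h2
  have h3 : (1 : ENNReal) ≤ ENNReal.ofReal (c + P.real T) := by
    rw [ENNReal.ofReal_add hc measureReal_nonneg, ofReal_measureReal]
    exact h2.trans (by gcongr)
  rw [ENNReal.one_le_ofReal] at h3
  linarith

theorem isNoiseNormConst_hundred : IsNoiseNormConst.{u} 100 := by
  intro n hn Ω _ P _ W hW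
  have h : P {ω | 100 * √(n : ℝ) < opNorm (W ω)} ≤ ENNReal.ofReal ((n : ℝ) ^ (-10 : ℤ) / 4) := by
    refine (hW.measure_le (measurableSet_opNorm_hermMatrix_gt _) fun ω hω => ?_).trans
      (entriesLaw_opNorm_gt_le_zpow hn)
    rw [Set.mem_ofPred_eq, hermMatrix_upperEntries (hW.herm ω) (hW.diag ω)]
    exact hω
  have h0 : (0 : ℝ) ≤ (n : ℝ) ^ (-10 : ℤ) := by positivity
  have := one_sub_le_measureReal (S := {ω | 100 * √(n : ℝ) < opNorm (W ω)})
    (T := {ω | opNorm (W ω) ≤ 100 * √(n : ℝ)}) (c := (n : ℝ) ^ (-10 : ℤ) / 4) (by positivity)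
    (Filter.Eventually.of_forall fun ω (hω : ¬ 100 * √(n : ℝ) < opNorm (W ω)) => not_lt.1 hω) h
  linarith

/-- The loss is an infimum of continuous functions, hence measurable. -/
lemma measurable_loss : Measurable fun q : (Fin m → Fin n → ℂ) × (Fin n → ℂ) =>
    loss (Matrix.of q.1) q.2 := by
  have h : UpperSemicontinuous fun q : (Fin m → Fin n → ℂ) × (Fin n → ℂ) =>
      loss (Matrix.of q.1) q.2 := by
    refine upperSemicontinuous_ciInf (fun q => bddBelow_range_loss _ _) fun a => ?_
    refine Continuous.upperSemicontinuous ?_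
    simp only [Matrix.of_apply]
    fun_prop
  exact h.measurable

lemma aemeasurable_loss {zhat : Ω → Fin n → ℂ} {Vhat : Ω → Matrix (Fin m) (Fin n) ℂ}
    (hz : ∀ j, AEMeasurable (fun ω => zhat ω j) P)
    (hV : ∀ i j, AEMeasurable (fun ω => Vhat ω i j) P) :
    AEMeasurable (fun ω => loss (Vhat ω) (zhat ω)) P := by
  have h1 : AEMeasurable (fun ω => ((fun i j => Vhat ω i j, zhat ω) :
      (Fin m → Fin n → ℂ) × (Fin n → ℂ))) P :=
    (aemeasurable_pi_lambda _ fun i => aemeasurable_pi_lambda _ fun j => hV i j).prodMk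
      (aemeasurable_pi_lambda _ hz)
  have h2 : (fun ω => loss (Vhat ω) (zhat ω)) =
      (fun q : (Fin m → Fin n → ℂ) × (Fin n → ℂ) => loss (Matrix.of q.1) q.2) ∘
        fun ω => ((fun i j => Vhat ω i j, zhat ω) : (Fin m → Fin n → ℂ) × (Fin n → ℂ)) := by
    funext ω
    rfl
  rw [h2]
  exact Measurable.comp_aemeasurable measurable_loss h1

/-- Outside the event of large noise norm, the loss is at most `16 / n` times the number of columns
with large noise, each of which has Gaussian probability. -/
lemma exists_loss_le_sum_indicator [IsProbabilityMeasure P] (hm : 1 ≤ m) (hn : 1 ≤ n) {σ : ℝ}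
    (hσ : 0 < σ) (hx : (10 : ℝ) ^ 10 ≤ n / σ ^ 2) {zs : Fin n → ℂ} (hzs : zs ∈ phases n)
    {W : Ω → Matrix (Fin n) (Fin n) ℂ} {zhat : Ω → Fin n → ℂ}
    {Vhat : Ω → Matrix (Fin m) (Fin n) ℂ} (hW : IsNoiseMatrix P W)
    (hz : ∀ᵐ ω ∂P, IsMLE (obs σ zs (W ω)) (zhat ω))
    (hV : ∀ᵐ ω ∂P, IsBM (obs σ zs (W ω)) (Vhat ω)) :
    ∃ (S₀ : Set (Pairs n → ℂ)) (S : Fin n → Set (Pairs n → ℂ)), MeasurableSet S₀ ∧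
      (∀ j, MeasurableSet (S j)) ∧
      entriesLaw n S₀ ≤ ENNReal.ofReal ((n : ℝ) ^ (-10 : ℤ) / 4) ∧
      (∀ j, entriesLaw n (S j) ≤ ENNReal.ofReal (4 * Real.exp (-(9 / 32 * (n / σ ^ 2))))) ∧
      ∀ᵐ ω ∂P, loss (Vhat ω) (zhat ω) ≤
        16 / n * ∑ j, (S j).indicator 1 (upperEntries (W ω)) +
          4 * S₀.indicator 1 (upperEntries (W ω)) := by
  have hn' : (0 : ℝ) < n := by exact_mod_cast hn
  have hs : 0 < σ / n := by positivity
  have hK : 0 ≤ 100 * √(n : ℝ) := by positivity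
  -- the lower bound on `n / σ²` makes the noise-to-signal parameter small enough to contract
  have hsK : σ / n * (100 * √(n : ℝ)) ≤ 1 / 1000 := by
    refine le_of_sq_le_sq ?_ (by norm_num)
    rw [le_div_iff₀ (by positivity)] at hx
    rw [mul_pow, div_pow, mul_pow, Real.sq_sqrt hn'.le, div_mul_eq_mul_div,
      div_le_iff₀ (by positivity)]
    nlinarith
  choose S hSm hSP hS using fun j => exists_measurableSet_large_noise hn hzs hK hs hsK j
  refine ⟨{u | 100 * √(n : ℝ) < opNorm (hermMatrix u)}, S, measurableSet_opNorm_hermMatrix_gt _,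
    hSm, entriesLaw_opNorm_gt_le_zpow hn, fun j => ?_, ?_⟩
  · refine (hSP j).trans (le_of_eq ?_)
    congr 4
    field_simp
  · filter_upwards [hz, hV] with ω hzω hVω
    have hu := hermMatrix_upperEntries (hW.herm ω) (hW.diag ω)
    set u := upperEntries (W ω)
    have hsum : 0 ≤ 16 / (n : ℝ) * ∑ j, (S j).indicator 1 u :=
      mul_nonneg (by positivity) (Finset.sum_nonneg fun j _ =>
        Set.indicator_nonneg (fun _ _ => zero_le_one) _)
    by_cases hop : 100 * √(n : ℝ) < opNorm (hermMatrix u)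
    · rw [Set.indicator_of_mem (by exact hop)]
      have := loss_le_four hm hVω.1 hzω.1
      rw [Pi.one_apply]
      linarith
    · rw [Set.indicator_of_notMem (by exact hop), mul_zero, add_zero]
      rw [← hu] at hzω hVω
      refine (loss_le_card hn hzs (isHermitian_hermMatrix u) (hermMatrix_self u) (not_lt.1 hop)
        hσ.le hsK hVω hzω).trans ?_
      gcongr with j _
      split_ifs with hj
      · rw [Set.indicator_of_mem (hS j u (not_lt.1 hop) hj)]
        simp
      · exact Set.indicator_nonneg (fun _ _ => zero_le_one) _

lemma integrable_and_integral_le_of_le_sum_indicator {α : Type*} [MeasurableSpace α]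
    {ν : Measure α} [IsProbabilityMeasure ν] {X : Ω → α} (hX : HasLaw X ν P) {f : Ω → ℝ}
    (hf : AEMeasurable f P) (hf0 : ∀ ω, 0 ≤ f ω) {S₀ : Set α} {S : Fin n → Set α}
    (hS₀ : MeasurableSet S₀) (hS : ∀ j, MeasurableSet (S j)) {a b p q : ℝ} (ha : 0 ≤ a)
    (hb : 0 ≤ b) (hp : 0 ≤ p) (hq : 0 ≤ q) (hP₀ : ν S₀ ≤ ENNReal.ofReal q)
    (hP : ∀ j, ν (S j) ≤ ENNReal.ofReal p)
    (hle : ∀ᵐ ω ∂P, f ω ≤ a * ∑ j, (S j).indicator 1 (X ω) + b * S₀.indicator 1 (X ω)) :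
    Integrable f P ∧ ∫ ω, f ω ∂P ≤ a * (n * p) + b * q := by
  have hint : ∀ T : Set α, MeasurableSet T → Integrable (T.indicator (1 : α → ℝ)) ν :=
    fun T hT => (integrable_const (1 : ℝ)).indicator hT
  have h1 : Integrable (fun x => a * ∑ j, (S j).indicator (1 : α → ℝ) x) ν :=
    (integrable_finsetSum _ fun j _ => hint _ (hS j)).const_mul a
  have h2 : Integrable (fun x => b * S₀.indicator (1 : α → ℝ) x) ν := (hint _ hS₀).const_mul b
  set B : α → ℝ := fun x => a * ∑ j, (S j).indicator 1 x + b * S₀.indicator 1 x with hBdef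
  have hB : Integrable B ν := h1.add h2
  have hBP : Integrable (fun ω => B (X ω)) P := by
    have h := hB
    rw [← hX.map_eq] at h
    exact h.comp_aemeasurable hX.aemeasurable
  have hfint : Integrable f P := by
    refine hBP.mono' hf.aestronglyMeasurable ?_
    filter_upwards [hle] with ω hω
    rw [Real.norm_of_nonneg (hf0 ω)]
    exact hω
  refine ⟨hfint, ?_⟩
  have hreal₀ : ν.real S₀ ≤ q := ENNReal.toReal_le_of_le_ofReal hq hP₀
  have hreal : ∀ j, ν.real (S j) ≤ p := fun j => ENNReal.toReal_le_of_le_ofReal hp (hP j)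
  calc ∫ ω, f ω ∂P ≤ ∫ ω, B (X ω) ∂P := integral_mono_ae hfint hBP hle
    _ = ∫ x, B x ∂ν := hX.integral_comp hB.aestronglyMeasurable
    _ = a * ∑ j, ν.real (S j) + b * ν.real S₀ := by
        rw [hBdef, integral_add h1 h2, integral_const_mul, integral_const_mul,
          integral_finsetSum _ fun j _ => hint _ (hS j), integral_indicator_one hS₀]
        congr 2
        exact Finset.sum_congr rfl fun j _ => integral_indicator_one (hS j)
    _ ≤ a * ∑ _j : Fin n, p + b * q := by
        gcongr with j _
        exact hreal j
    _ = _ := by rw [Finset.sum_const, Finset.card_univ, Fintype.card_fin, nsmul_eq_mul]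

/-- The surplus of `9 / 32` over `1 / 8` in the exponent absorbs the constant factor. -/
lemma exp_bound_expectation {x : ℝ} (hx : (10 : ℝ) ^ 10 ≤ x) :
    16 * (4 * Real.exp (-(9 / 32 * x))) ≤ Real.exp (-(x / 8)) := by
  have h1 : Real.exp (-(9 / 32 * x)) = Real.exp (-(x / 8)) * Real.exp (-(5 / 32 * x)) := by
    rw [← Real.exp_add]; ring_nf
  have h2 : (64 : ℝ) ≤ Real.exp (5 / 32 * x) := by
    linarith [Real.add_one_le_exp (5 / 32 * x)]
  have h3 : 64 * Real.exp (-(5 / 32 * x)) ≤ 1 := by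
    rw [Real.exp_neg, ← div_eq_mul_inv, div_le_one (Real.exp_pos _)]
    exact h2
  rw [h1]
  nlinarith [Real.exp_pos (-(x / 8))]

/-- The threshold `9 log n` turns `exp (-2 x / 9)` into `n⁻²`, which beats the `n` terms of the
union bound; the rest of the exponent absorbs the constant factor. -/
lemma exp_bound_probability (hn : 1 ≤ n) {x : ℝ} (hx : (10 : ℝ) ^ 10 ≤ x)
    (hlog : 9 * Real.log n ≤ x) :
    n * (4 * Real.exp (-(9 / 32 * x))) + (n : ℝ) ^ (-10 : ℤ) / 4 ≤ (n : ℝ)⁻¹ := by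
  have hn' : (1 : ℝ) ≤ n := by exact_mod_cast hn
  have h1 : Real.exp (-(9 / 32 * x)) =
      Real.exp (-(2 / 9 * x)) * Real.exp (-(17 / 288 * x)) := by
    rw [← Real.exp_add]; ring_nf
  have h2 : Real.exp (-(2 / 9 * x)) ≤ (n : ℝ)⁻¹ * (n : ℝ)⁻¹ := by
    calc Real.exp (-(2 / 9 * x)) ≤ Real.exp (-Real.log n + -Real.log n) :=
          Real.exp_le_exp.2 (by linarith)
      _ = _ := by rw [Real.exp_add, Real.exp_neg, Real.exp_log (by linarith)]
  have h3 : 8 * Real.exp (-(17 / 288 * x)) ≤ 1 := by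
    rw [Real.exp_neg, ← div_eq_mul_inv, div_le_one (Real.exp_pos _)]
    linarith [Real.add_one_le_exp (17 / 288 * x)]
  have h4 : (n : ℝ) ^ (-10 : ℤ) ≤ (n : ℝ)⁻¹ := by
    rw [← _root_.zpow_neg_one]
    exact zpow_le_zpow_right₀ hn' (by norm_num)
  have h5 : n * (4 * Real.exp (-(9 / 32 * x))) ≤ (n : ℝ)⁻¹ * (1 / 2) := by
    rw [h1]
    calc n * (4 * (Real.exp (-(2 / 9 * x)) * Real.exp (-(17 / 288 * x))))
        ≤ n * (4 * ((n : ℝ)⁻¹ * (n : ℝ)⁻¹ * (1 / 8))) := by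
          gcongr
          linarith
      _ = _ := by field_simp; norm_num
  have h6 : 0 < (n : ℝ)⁻¹ := by positivity
  linarith

end Final

end PhaseSync

theorem theorem4 :
    (∃ C₀ : ℝ, 0 < C₀ ∧ PhaseSync.IsNoiseNormConst.{u} C₀) ∧
    ∀ C₀ : ℝ, 0 < C₀ → PhaseSync.IsNoiseNormConst.{u} C₀ →
      ∃ C₁ C₂ : ℝ, 0 < C₁ ∧ 0 < C₂ ∧
        ∀ (m n : ℕ), 2 ≤ m → 1 ≤ n →
        ∀ (σ : ℝ), 0 < σ → ∀ zstar ∈ PhaseSync.phases n,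
        ∀ (Ω : Type u) [MeasurableSpace Ω] (P : Measure Ω) [IsProbabilityMeasure P]
          (W : Ω → Matrix (Fin n) (Fin n) ℂ)
          (zhat : Ω → Fin n → ℂ) (Vhat : Ω → Matrix (Fin m) (Fin n) ℂ),
          PhaseSync.IsNoiseMatrix P W →
          (∀ j, AEMeasurable (fun ω => zhat ω j) P) →
          (∀ i j, AEMeasurable (fun ω => Vhat ω i j) P) →
          (∀ᵐ ω ∂P, PhaseSync.IsMLE (PhaseSync.obs σ zstar (W ω)) (zhat ω)) →
          (∀ᵐ ω ∂P, PhaseSync.IsBM (PhaseSync.obs σ zstar (W ω)) (Vhat ω)) →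
          (C₁ ≤ (n : ℝ) / σ ^ 2 →
            Integrable (fun ω => PhaseSync.loss (Vhat ω) (zhat ω)) P ∧
            ∫ ω, PhaseSync.loss (Vhat ω) (zhat ω) ∂P
              ≤ Real.exp (-((n : ℝ) / (8 * σ ^ 2))) + (n : ℝ) ^ (-10 : ℤ)) ∧
          (max C₂ (9 * Real.log (n : ℝ)) ≤ (n : ℝ) / σ ^ 2 →
            1 - (n : ℝ)⁻¹ ≤ P.real {ω | PhaseSync.loss (Vhat ω) (zhat ω) = 0}) := by
  open PhaseSync in
  refine ⟨⟨100, by norm_num, isNoiseNormConst_hundred⟩, fun _ _ _ => ⟨10 ^ 10, 10 ^ 10,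
    by norm_num, by norm_num, ?_⟩⟩
  intro m n hm hn σ hσ zs hzs Ω _ P _ W zhat Vhat hW hzm hVm hz hV
  have hn' : (0 : ℝ) < n := by exact_mod_cast hn
  have hlaw := hW.hasLaw_upperEntries
  have hmeas := aemeasurable_loss hzm hVm
  refine ⟨fun hx => ?_, fun hx => ?_⟩
  · obtain ⟨S₀, S, hS₀, hS, hP₀, hPS, hle⟩ :=
      exists_loss_le_sum_indicator (by omega) hn hσ hx hzs hW hz hV
    have h := integrable_and_integral_le_of_le_sum_indicator (a := 16 / n) (b := 4)
      (p := 4 * Real.exp (-(9 / 32 * (n / σ ^ 2)))) (q := (n : ℝ) ^ (-10 : ℤ) / 4) hlaw hmeas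
      (fun ω => loss_nonneg (Vhat ω) (zhat ω)) hS₀ hS (by positivity) zero_le_four
      (mul_nonneg zero_le_four (Real.exp_pos _).le)
      (div_nonneg (zpow_nonneg hn'.le _) zero_le_four) hP₀ hPS hle
    refine ⟨h.1, h.2.trans ?_⟩
    have h2 := exp_bound_expectation hx
    rw [div_div, mul_comm (σ ^ 2)] at h2
    have h3 : 16 / (n : ℝ) * (n * (4 * Real.exp (-(9 / 32 * (n / σ ^ 2))))) =
        16 * (4 * Real.exp (-(9 / 32 * (n / σ ^ 2)))) := by field_simp
    rw [h3]
    linarith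
  · obtain ⟨S₀, S, hS₀, hS, hP₀, hPS, hle⟩ :=
      exists_loss_le_sum_indicator (by omega) hn hσ ((le_max_left _ _).trans hx) hzs hW hz hV
    have hbound := exp_bound_probability hn ((le_max_left _ _).trans hx)
      ((le_max_right _ _).trans hx)
    set p : ℝ := 4 * Real.exp (-(9 / 32 * (n / σ ^ 2))) with hp
    have hp0 : 0 ≤ p := by positivity
    have hunion : entriesLaw n ((⋃ j, S j) ∪ S₀) ≤
        ENNReal.ofReal (n * p + (n : ℝ) ^ (-10 : ℤ) / 4) := by
      calc _ ≤ ∑ j, entriesLaw n (S j) + entriesLaw n S₀ :=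
            (measure_union_le _ _).trans (add_le_add_left (measure_iUnion_fintype_le _ _) _)
        _ ≤ ∑ _j : Fin n, ENNReal.ofReal p + ENNReal.ofReal ((n : ℝ) ^ (-10 : ℤ) / 4) := by
            gcongr with j _
            exact hPS j
        _ = _ := by
            rw [Finset.sum_const, Finset.card_univ, Fintype.card_fin, nsmul_eq_mul,
              ENNReal.ofReal_add (by positivity) (by positivity), ENNReal.ofReal_mul hn'.le,
              ENNReal.ofReal_natCast]
    have hPT := (hW.measure_le ((MeasurableSet.iUnion hS).union hS₀)
      (T := {ω | upperEntries (W ω) ∈ (⋃ j, S j) ∪ S₀}) fun ω hω => hω).trans hunion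
    refine (sub_le_sub_left hbound 1).trans
      (one_sub_le_measureReal (by positivity) ?_ hPT)
    filter_upwards [hle] with ω hω hnot
    simp only [Set.mem_union, Set.mem_iUnion, not_or, not_exists] at hnot
    rw [Set.indicator_of_notMem hnot.2, Finset.sum_eq_zero fun j _ =>
      Set.indicator_of_notMem (hnot.1 j) _] at hω
    exact le_antisymm (by simpa using hω) (loss_nonneg _ _)
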